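/- Let $m\ge 3$. Let $\mathcal{W}(m)=(\mathbb{R}^m)^*\otimes(\mathbb{R}^m)^*\otimes\mathbb{R}^m$ be the space of constant Christoffel symbols $\Gamma=(\Gamma_{ij}{}^k)$ on $\mathbb{R}^m$, and let $\mathcal{Z}(m)\subset\mathcal{W}(m)$ be the linear subspace of torsion free ones, $\Gamma_{ij}{}^k=\Gamma_{ji}{}^k$. The Ricci tensor of $\Gamma$ is $\rho_{\Gamma,jk}=\sum_{i,n}(\Gamma_{in}{}^i\Gamma_{jk}{}^n-\Gamma_{jn}{}^i\Gamma_{ik}{}^n)$ and its symmetrization is $\rho_{s,\Gamma,jk}=\frac12(\rho_{\Gamma,jk}+\rho_{\Gamma,kj})$. Let $\mathcal{W}(p,q)$ (respectively $\mathcal{Z}(p,q)$) be the set of $\Gamma$ in $\mathcal{W}(m)$ (respectively $\mathcal{Z}(m)$) such that $\rho_{s,\Gamma}$ has signature $(p,q)$, i.e. $p$ negative and $q$ positive directions. The group $\mathrm{GL}^+(m,\mathbb{R})$ of linear maps of positive determinant acts on these spaces by linear change of coordinates, $(T\Gamma)(x,y)=T\,\Gamma(T^{-1}x,T^{-1}y)$.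 Let $G_\Gamma^+=\{T\in\mathrm{GL}^+(m,\mathbb{R}):T\Gamma=\Gamma\}$ be the isotropy group of $\Gamma$, and let $$\tilde{\mathcal{W}}(p,q)=\{\Gamma\in\mathcal{W}(p,q):G_\Gamma^+=\{\mathrm{id}\}\},\qquad \tilde{\mathcal{Z}}(p,q)=\{\Gamma\in\mathcal{Z}(p,q):G_\Gamma^+=\{\mathrm{id}\}\},$$ $$\tilde{\mathfrak{W}}^+(p,q)=\tilde{\mathcal{W}}(p,q)/\mathrm{GL}^+(m,\mathbb{R}),\qquad \tilde{\mathfrak{Z}}^+(p,q)=\tilde{\mathcal{Z}}(p,q)/\mathrm{GL}^+(m,\mathbb{R}).$$ Let $(p,q)\in\{(m,0),(0,m)\}$. Then: 1. The action of $\mathrm{GL}^+(m,\mathbb{R})$ on $\mathcal{W}(p,q)$ and on $\mathcal{Z}(p,q)$ is proper: if $\Gamma_n\to\Gamma$ and $T_n\Gamma_n\to\tilde\Gamma$ in the space, then a subsequence of $(T_n)$ converges in $\mathrm{GL}^+(m,\mathbb{R})$. 2. $\tilde{\mathcal{W}}(p,q)$ and $\tilde{\mathcal{Z}}(p,q)$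 are open dense subsets of $\mathcal{W}(p,q)$ and $\mathcal{Z}(p,q)$, respectively. 3. $\tilde{\mathcal{W}}(p,q)$ and $\tilde{\mathcal{Z}}(p,q)$ are open in $\mathcal{W}(m)$ and $\mathcal{Z}(m)$, and the moduli spaces $\tilde{\mathfrak{W}}^+(p,q)$ and $\tilde{\mathfrak{Z}}^+(p,q)$, with the quotient topology, are Hausdorff and second countable and carry natural smooth structures (a function on an open subset of the quotient is smooth if and only if its pullback is smooth) such that $\tilde{\mathcal{W}}(p,q)\to\tilde{\mathfrak{W}}^+(p,q)$ and $\tilde{\mathcal{Z}}(p,q)\to\tilde{\mathfrak{Z}}^+(p,q)$ are smooth principal $\mathrm{GL}^+(m,\mathbb{R})$-bundles. -/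

import Mathlib

open Filter Topology
open scoped Manifold ContDiff Matrix MatrixGroups

noncomputable section

/-! ### Constant Christoffel symbols and the action of the general linear group -/

/-- The space `𝒲(m)` of constant Christoffel symbols on `ℝ^m`; `Γ i j k` is `Γ_{ij}^k`. -/
def Christoffel (m : ℕ) : Type := Fin m → Fin m → Fin m → ℝ

namespace Christoffel

variable {m : ℕ}

instance : NormedAddCommGroup (Christoffel m) :=
  inferInstanceAs (NormedAddCommGroup (Fin m → Fin m → Fin m → ℝ))

instance : NormedSpace ℝ (Christoffel m) :=
  inferInstanceAs (NormedSpace ℝ (Fin m → Fin m → Fin m → ℝ))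

instance : FiniteDimensional ℝ (Christoffel m) :=
  inferInstanceAs (FiniteDimensional ℝ (Fin m → Fin m → Fin m → ℝ))

/-- Christoffel symbols in the frame `T e_1, …, T e_m`:
`(changeFrame T Γ)(e_i, e_j, e^k) = Γ(T e_i, T e_j, T e^k)`, where `T e_i = ∑ a, T a i • e_a` and
`T e^1, …, T e^m` is the basis dual to `T e_1, …, T e_m`, i.e. `T e^k = ∑ c, T⁻¹ k c • e^c`. -/
def changeFrame (T : GL (Fin m) ℝ) (Γ : Christoffel m) : Christoffel m := fun i j k =>
  ∑ a, ∑ b, ∑ c, T.1 a i * T.1 b j * T⁻¹.1 k c * Γ a b c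

theorem changeFrame_eq (T : GL (Fin m) ℝ) (Γ : Christoffel m) (i : Fin m) :
    (Matrix.of (changeFrame T Γ i) : Matrix (Fin m) (Fin m) ℝ) =
      T.1ᵀ * (∑ a, T.1 a i • Matrix.of (Γ a)) * T⁻¹.1ᵀ := by
  ext j k
  simp only [changeFrame, Matrix.of_apply, Matrix.mul_apply, Matrix.sum_apply, Matrix.smul_apply,
    Matrix.transpose_apply, smul_eq_mul, Finset.mul_sum, Finset.sum_mul]
  calc
    _ = ∑ a, ∑ c, ∑ b, T.1 a i * T.1 b j * T⁻¹.1 k c * Γ a b c :=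
        Finset.sum_congr rfl fun a _ => Finset.sum_comm
    _ = ∑ c, ∑ a, ∑ b, T.1 a i * T.1 b j * T⁻¹.1 k c * Γ a b c := Finset.sum_comm
    _ = _ := Finset.sum_congr rfl fun c _ => ?_
  exact Finset.sum_congr rfl fun a _ => Finset.sum_congr rfl fun b _ => by ring

theorem changeFrame_one (Γ : Christoffel m) : changeFrame 1 Γ = Γ := by
  funext i
  refine Matrix.of.injective ?_
  rw [changeFrame_eq]
  simp [Matrix.one_apply]

theorem changeFrame_mul (S T : GL (Fin m) ℝ) (Γ : Christoffel m) :
    changeFrame (S * T) Γ = changeFrame T (changeFrame S Γ) := by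
  funext i
  refine Matrix.of.injective ?_
  simp only [changeFrame_eq]
  simp only [mul_inv_rev, Units.val_mul, Matrix.transpose_mul, Matrix.mul_sum, Matrix.sum_mul,
    Matrix.mul_smul, Matrix.smul_mul, Matrix.mul_assoc, Matrix.mul_apply, Finset.sum_smul,
    Finset.smul_sum, smul_smul]
  rw [Finset.sum_comm]
  refine Finset.sum_congr rfl fun a _ => Finset.sum_congr rfl fun b _ => ?_
  rw [mul_comm]

/-- The action of the general linear group on Christoffel symbols by linear changes of
coordinates. As `changeFrame` reverses products, the inverse appears in the left action:
`(T • Γ)(x, y) = T (Γ (T⁻¹ x, T⁻¹ y))`. -/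
instance : MulAction (GL (Fin m) ℝ) (Christoffel m) where
  smul T Γ := changeFrame T⁻¹ Γ
  one_smul Γ := by
    change changeFrame 1⁻¹ Γ = Γ
    rw [inv_one, changeFrame_one]
  mul_smul S T Γ := by
    change changeFrame (S * T)⁻¹ Γ = changeFrame S⁻¹ (changeFrame T⁻¹ Γ)
    rw [mul_inv_rev, changeFrame_mul]

theorem smul_def (T : GL (Fin m) ℝ) (Γ : Christoffel m) : T • Γ = changeFrame T⁻¹ Γ := rfl

/-! ### The Ricci tensor and its signature -/

/-- The Ricci tensor `ρ_{jk} = Γ_{in}^i Γ_{jk}^n - Γ_{jn}^i Γ_{ik}^n` of the connection on `ℝ^m`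
with constant Christoffel symbols `Γ`. -/
def ricci (Γ : Christoffel m) : Matrix (Fin m) (Fin m) ℝ := Matrix.of fun j k =>
  ∑ i, ∑ n, (Γ i n i * Γ j k n - Γ j n i * Γ i k n)

/-- The symmetric Ricci tensor. -/
def symRicci (Γ : Christoffel m) : Matrix (Fin m) (Fin m) ℝ :=
  (1 / 2 : ℝ) • (Γ.ricci + Γ.ricciᵀ)

/-- The symmetric Ricci tensor has signature `(p, q)`: `p` timelike (negative) and
`q` spacelike (positive) directions. -/
def HasSignature (Γ : Christoffel m) (p q : ℕ) : Prop :=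
  sigNeg Γ.symRicci.toQuadraticForm' = p ∧ sigPos Γ.symRicci.toQuadraticForm' = q

/-- The matrix `(i, n) ↦ Γ_{ik}^n`. -/
def rightSlice (Γ : Christoffel m) (k : Fin m) : Matrix (Fin m) (Fin m) ℝ :=
  Matrix.of fun i n => Γ i k n

theorem rightSlice_changeFrame (T : GL (Fin m) ℝ) (Γ : Christoffel m) (k : Fin m) :
    (changeFrame T Γ).rightSlice k = T.1ᵀ * (∑ b, T.1 b k • Γ.rightSlice b) * T⁻¹.1ᵀ := by
  have h := changeFrame_eq T (fun i j n => Γ j i n) k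
  have h' : (changeFrame T Γ).rightSlice k = Matrix.of (changeFrame T (fun i j n => Γ j i n) k) := by
    ext i n
    simp only [rightSlice, changeFrame, Matrix.of_apply]
    rw [Finset.sum_comm]
    exact Finset.sum_congr rfl fun b _ => Finset.sum_congr rfl fun a _ =>
      Finset.sum_congr rfl fun c _ => by ring
  rw [h', h]
  rfl

theorem ricci_eq (Γ : Christoffel m) (j k : Fin m) :
    Γ.ricci j k = (Matrix.of (Γ j) *ᵥ fun n => (Γ.rightSlice n).trace) k -
      (Matrix.of (Γ j) * Γ.rightSlice k).trace := by
  simp only [ricci, Matrix.of_apply, Finset.sum_sub_distrib, Matrix.mulVec, dotProduct,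
    Matrix.trace, Matrix.diag, Matrix.mul_apply, rightSlice, Finset.mul_sum]
  congr 1
  · rw [Finset.sum_comm]
    exact Finset.sum_congr rfl fun n _ => Finset.sum_congr rfl fun i _ => mul_comm _ _
  · rw [Finset.sum_comm]

theorem ricci_changeFrame (T : GL (Fin m) ℝ) (Γ : Christoffel m) :
    (changeFrame T Γ).ricci = T.1ᵀ * Γ.ricci * T.1 := by
  have hT : T⁻¹.1ᵀ * T.1ᵀ = 1 := by
    rw [← Matrix.transpose_mul, ← Units.val_mul]
    simp
  have hω : (fun n => ((changeFrame T Γ).rightSlice n).trace) =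
      T.1ᵀ *ᵥ fun n => (Γ.rightSlice n).trace := by
    funext n
    rw [rightSlice_changeFrame, Matrix.trace_mul_comm, ← Matrix.mul_assoc, hT, Matrix.one_mul,
      Matrix.trace_sum]
    simp [Matrix.mulVec, dotProduct, Matrix.trace_smul]
  ext j k
  rw [ricci_eq, hω, changeFrame_eq, rightSlice_changeFrame, Matrix.mulVec_mulVec]
  have h1 : T.1ᵀ * (∑ a, T.1 a j • Matrix.of (Γ a)) * T⁻¹.1ᵀ * T.1ᵀ =
      T.1ᵀ * (∑ a, T.1 a j • Matrix.of (Γ a)) := by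
    rw [Matrix.mul_assoc, hT, Matrix.mul_one]
  rw [h1, ← Matrix.mul_assoc, ← Matrix.mul_assoc, h1, Matrix.trace_mul_comm, ← Matrix.mul_assoc,
    ← Matrix.mul_assoc, hT, Matrix.one_mul]
  set w : Fin m → ℝ := fun n => (Γ.rightSlice n).trace with hw
  have h2 : ((T.1ᵀ * ∑ a, T.1 a j • Matrix.of (Γ a)) *ᵥ w) k =
      ∑ b, ∑ a, T.1 a j * (Matrix.of (Γ a) *ᵥ w) b * T.1 b k := by
    rw [← Matrix.mulVec_mulVec]
    change ∑ b, T.1ᵀ k b * ((∑ a, T.1 a j • Matrix.of (Γ a)) *ᵥ w) b = _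
    refine Finset.sum_congr rfl fun b _ => ?_
    rw [Matrix.sum_mulVec, Finset.sum_apply, Finset.mul_sum]
    refine Finset.sum_congr rfl fun a _ => ?_
    rw [Matrix.smul_mulVec, Pi.smul_apply, Matrix.transpose_apply, smul_eq_mul]
    ring
  rw [h2]
  simp only [Matrix.mul_apply, ricci_eq, Finset.sum_mul, mul_sub, sub_mul, Matrix.trace_sum,
    Matrix.mul_sum, Finset.sum_sub_distrib, Matrix.smul_mul,
    Matrix.mul_smul, Matrix.trace_smul, smul_eq_mul, Matrix.transpose_apply, ← hw]
  congr 1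
  rw [Finset.sum_comm]
  exact Finset.sum_congr rfl fun b _ => Finset.sum_congr rfl fun a _ => by ring

theorem symRicci_changeFrame (T : GL (Fin m) ℝ) (Γ : Christoffel m) :
    (changeFrame T Γ).symRicci = T.1ᵀ * Γ.symRicci * T.1 := by
  simp only [symRicci, ricci_changeFrame, Matrix.transpose_mul, Matrix.transpose_transpose,
    Matrix.mul_smul, Matrix.smul_mul, Matrix.mul_add, Matrix.add_mul, Matrix.mul_assoc]

theorem equivalent_smul (T : GL (Fin m) ℝ) (Γ : Christoffel m) :
    QuadraticMap.Equivalent (T • Γ).symRicci.toQuadraticForm' Γ.symRicci.toQuadraticForm' := by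
  refine ⟨⟨LinearMap.GeneralLinearGroup.generalLinearEquiv ℝ _
    (Matrix.GeneralLinearGroup.toLin T⁻¹), fun x => ?_⟩⟩
  change Matrix.toLinearMap₂' ℝ Γ.symRicci (T⁻¹.1 *ᵥ x) (T⁻¹.1 *ᵥ x) =
    Matrix.toLinearMap₂' ℝ (changeFrame T⁻¹ Γ).symRicci x x
  rw [symRicci_changeFrame, Matrix.toLinearMap₂'_apply', Matrix.toLinearMap₂'_apply',
    ← Matrix.mulVec_mulVec, ← Matrix.mulVec_mulVec, Matrix.mulVec_transpose,
    dotProduct_comm x, ← Matrix.dotProduct_mulVec, dotProduct_comm]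

theorem HasSignature.smul {Γ : Christoffel m} {p q : ℕ} (h : Γ.HasSignature p q)
    (T : GL (Fin m) ℝ) : (T • Γ).HasSignature p q :=
  ⟨(equivalent_smul T Γ).sigNeg_eq.trans h.1, (equivalent_smul T Γ).sigPos_eq.trans h.2⟩

/-! ### The parameter spaces -/

/-- The space `𝒵(m)` of torsion free (symmetric) Christoffel symbols. -/
def symm (m : ℕ) : Submodule ℝ (Christoffel m) where
  carrier := {Γ | ∀ i j k, Γ i j k = Γ j i k}
  zero_mem' _ _ _ := rfl
  add_mem' hΓ hΔ i j k := congrArg₂ (· + ·) (hΓ i j k) (hΔ i j k)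
  smul_mem' c _ hΓ i j k := congrArg (c * ·) (hΓ i j k)

theorem smul_mem_symm (T : GL (Fin m) ℝ) {Γ : Christoffel m} (hΓ : Γ ∈ symm m) :
    T • Γ ∈ symm m := by
  intro i j k
  change ∑ a, ∑ b, ∑ c, T⁻¹.1 a i * T⁻¹.1 b j * T⁻¹⁻¹.1 k c * Γ a b c =
    ∑ a, ∑ b, ∑ c, T⁻¹.1 a j * T⁻¹.1 b i * T⁻¹⁻¹.1 k c * Γ a b c
  rw [Finset.sum_comm]
  refine Finset.sum_congr rfl fun b _ => Finset.sum_congr rfl fun a _ =>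
    Finset.sum_congr rfl fun c _ => ?_
  rw [hΓ a b c]
  ring

/-- The general linear group acts on the torsion free Christoffel symbols. -/
instance : MulAction (GL (Fin m) ℝ) (symm m) where
  smul T Γ := ⟨T • Γ.1, smul_mem_symm T Γ.2⟩
  one_smul Γ := Subtype.ext (one_smul _ Γ.1)
  mul_smul S T Γ := Subtype.ext (mul_smul S T Γ.1)

/-- `𝒲(p, q)`, with the action of `GL⁺(m, ℝ)`. -/
def W (m p q : ℕ) : SubMulAction GL(m, ℝ)⁺ (Christoffel m) where
  carrier := {Γ | Γ.HasSignature p q}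
  smul_mem' T _ hΓ := hΓ.smul (T : GL (Fin m) ℝ)

/-- `𝒵(p, q)`, with the action of `GL⁺(m, ℝ)`. -/
def Z (m p q : ℕ) : SubMulAction GL(m, ℝ)⁺ (symm m) where
  carrier := {Γ | (Γ : Christoffel m).HasSignature p q}
  smul_mem' T _ hΓ := hΓ.smul (T : GL (Fin m) ℝ)

end Christoffel

/-- The points of an invariant set at which the isotropy group is trivial. -/
def SubMulAction.trivialIsotropy {G X : Type*} [Group G] [MulAction G X] (N : SubMulAction G X) :
    SubMulAction G X where
  carrier := {x | x ∈ N ∧ MulAction.stabilizer G x = ⊥}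
  smul_mem' g x hx := by
    refine ⟨N.smul_mem g hx.1, ?_⟩
    rw [MulAction.stabilizer_smul_eq_stabilizer_map_conj, hx.2, Subgroup.map_bot]

/-- The elements of `𝒲(p, q)` with trivial isotropy group in `GL⁺(m, ℝ)`. -/
abbrev Christoffel.WTilde (m p q : ℕ) : SubMulAction GL(m, ℝ)⁺ (Christoffel m) :=
  (Christoffel.W m p q).trivialIsotropy

/-- The elements of `𝒵(p, q)` with trivial isotropy group in `GL⁺(m, ℝ)`. -/
abbrev Christoffel.ZTilde (m p q : ℕ) : SubMulAction GL(m, ℝ)⁺ (Christoffel.symm m) :=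
  (Christoffel.Z m p q).trivialIsotropy

/-! ### Proper actions and principal bundles -/

/-- An action is proper if, whenever `x_n → x` and `g_n x_n → y`, some subsequence of `g_n`
converges. -/
def IsProperAction (G X : Type*) [TopologicalSpace G] [TopologicalSpace X] [SMul G X] : Prop :=
  ∀ (x : ℕ → X) (g : ℕ → G) (a b : X), Tendsto x atTop (𝓝 a) →
    Tendsto (fun n => g n • x n) atTop (𝓝 b) →
      ∃ (φ : ℕ → ℕ) (h : G), StrictMono φ ∧ Tendsto (fun n => g (φ n)) atTop (𝓝 h)

namespace GLPos

variable {m : ℕ}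

/-- The matrix entries of an element of `GL⁺(m, ℝ)`. -/
def entries (T : GL(m, ℝ)⁺) : Fin m → Fin m → ℝ := fun i j => (T : GL (Fin m) ℝ).1 i j

open scoped Matrix.Norms.Operator in
theorem isOpenEmbedding_entries : IsOpenEmbedding (entries (m := m)) := by
  have hopen : IsOpen ((GL(m, ℝ)⁺ : Subgroup (GL (Fin m) ℝ)) : Set (GL (Fin m) ℝ)) := by
    have : IsOpen {T : GL (Fin m) ℝ | 0 < T.1.det} :=
      isOpen_lt continuous_const (Continuous.matrix_det Units.continuous_val)
    exact this
  have h1 : IsOpenEmbedding (Units.val : GL (Fin m) ℝ → Matrix (Fin m) (Fin m) ℝ) :=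
    Units.isOpenEmbedding_val
  exact h1.comp hopen.isOpenEmbedding_subtypeVal

/-- `GL⁺(m, ℝ)` is an open subset of the vector space of all matrices. -/
instance : ChartedSpace (Fin m → Fin m → ℝ) GL(m, ℝ)⁺ :=
  isOpenEmbedding_entries.singletonChartedSpace

theorem contMDiff_entries :
    ContMDiff 𝓘(ℝ, Fin m → Fin m → ℝ) 𝓘(ℝ, Fin m → Fin m → ℝ) ∞ (entries (m := m)) :=
  contMDiff_isOpenEmbedding isOpenEmbedding_entries

theorem contDiff_det : ContDiff ℝ ∞ fun A : Fin m → Fin m → ℝ => (Matrix.of A).det := by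
  simp only [Matrix.det_apply]
  refine ContDiff.sum fun σ _ => ContDiff.const_smul _ (contDiff_prod fun i _ => ?_)
  simp only [Matrix.of_apply]
  fun_prop

theorem contDiff_adjugate (i j : Fin m) :
    ContDiff ℝ ∞ fun A : Fin m → Fin m → ℝ => (Matrix.of A).adjugate i j := by
  simp only [Matrix.adjugate_apply]
  have h : ContDiff ℝ ∞ fun A : Fin m → Fin m → ℝ =>
      (fun k l => (Matrix.of A).updateRow j (Pi.single i 1) k l : Fin m → Fin m → ℝ) := ?_
  · exact contDiff_det.comp h
  refine contDiff_pi.2 fun k => contDiff_pi.2 fun l => ?_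
  simp only [Matrix.updateRow_apply]
  split_ifs
  · exact contDiff_const
  · simp only [Matrix.of_apply]
    fun_prop

instance : LieGroup 𝓘(ℝ, Fin m → Fin m → ℝ) ∞ GL(m, ℝ)⁺ where
  toIsManifold := isOpenEmbedding_entries.isManifold_singleton
  contMDiff_mul := by
    apply ContMDiff.of_comp_isOpenEmbedding isOpenEmbedding_entries
    have h : ContDiff ℝ ∞ fun x : (Fin m → Fin m → ℝ) × (Fin m → Fin m → ℝ) =>
        (fun i j => ∑ k, x.1 i k * x.2 k j : Fin m → Fin m → ℝ) := by fun_prop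
    exact h.contMDiff.comp
      ((contMDiff_entries.comp contMDiff_fst).prodMk_space (contMDiff_entries.comp contMDiff_snd))
  contMDiff_inv := by
    apply ContMDiff.of_comp_isOpenEmbedding isOpenEmbedding_entries
    intro T
    have hT : (Matrix.of (entries T)).det ≠ 0 := (Matrix.GLPos.det_ne_zero T)
    have h : ContDiffAt ℝ ∞ (fun A : Fin m → Fin m → ℝ =>
        (fun i j => (Matrix.of A).det⁻¹ * (Matrix.of A).adjugate i j : Fin m → Fin m → ℝ))
        (entries T) :=
      contDiffAt_pi.2 fun i => contDiffAt_pi.2 fun j =>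
        (contDiff_det.contDiffAt.inv hT).mul (contDiff_adjugate i j).contDiffAt
    refine (h.contMDiffAt.comp T (contMDiff_entries T)).congr_of_eventuallyEq
      (Eventually.of_forall fun S => ?_)
    funext i j
    have : ((S⁻¹ : GL(m, ℝ)⁺) : GL (Fin m) ℝ).1 = (S : GL (Fin m) ℝ).1⁻¹ :=
      Matrix.coe_units_inv _
    change ((S⁻¹ : GL(m, ℝ)⁺) : GL (Fin m) ℝ).1 i j = _
    rw [this, Matrix.inv_def, Ring.inverse_eq_inv']
    rfl

end GLPos

section Bundle

variable (EG EN EB : Type*) [NormedAddCommGroup EG] [NormedSpace ℝ EG]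
  [NormedAddCommGroup EN] [NormedSpace ℝ EN] [NormedAddCommGroup EB] [NormedSpace ℝ EB]

/-- `π : N → B` is a smooth principal bundle for the Lie group `G`, which acts on `N`: the action
and `π` are smooth, and `B` is covered by open sets over which there is an equivariant
diffeomorphism from `N` to the product with `G` compatible with the projections to `B`. (As usual
for an action written on the left, `G` acts on the product by left multiplication.) -/
structure IsSmoothPrincipalBundle (G : Type*) {N B : Type*} [Group G] [TopologicalSpace G]
    [ChartedSpace EG G] [LieGroup 𝓘(ℝ, EG) ∞ G] [TopologicalSpace N] [ChartedSpace EN N]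
    [TopologicalSpace B] [ChartedSpace EB B] [MulAction G N] (π : N → B) : Prop where
  contMDiff_smul : ContMDiff (𝓘(ℝ, EG).prod 𝓘(ℝ, EN)) 𝓘(ℝ, EN) ∞ fun x : G × N => x.1 • x.2
  contMDiff_proj : ContMDiff 𝓘(ℝ, EN) 𝓘(ℝ, EB) ∞ π
  surjective : Function.Surjective π
  proj_eq_iff : ∀ x y, π x = π y ↔ ∃ g : G, g • x = y
  exists_trivialization : ∀ b : B, ∃ e : Bundle.Trivialization G π, b ∈ e.baseSet ∧
    ContMDiffOn 𝓘(ℝ, EN) (𝓘(ℝ, EB).prod 𝓘(ℝ, EG)) ∞ e e.source ∧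
    ContMDiffOn (𝓘(ℝ, EB).prod 𝓘(ℝ, EG)) 𝓘(ℝ, EN) ∞ e.toOpenPartialHomeomorph.symm e.target ∧
    ∀ x ∈ e.source, ∀ g : G, e (g • x) = (π x, g * (e x).2)

end Bundle

/-- The quotient of an invariant set by the group action, with the quotient topology. -/
abbrev SubMulAction.Moduli {G X : Type*} [Group G] [MulAction G X] (N : SubMulAction G X) : Type _ :=
  Quotient (MulAction.orbitRel G N)

/-- For an open invariant subset `N` of a normed space `V`: the quotient space `N / G`, with the
quotient topology, is a (Hausdorff, second countable) smooth manifold such that `N → N / G` is a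
smooth principal `G`-bundle. The smooth structure is the natural one: a function on an open subset
of `N / G` is smooth if and only if its pullback to `N` is. -/
def HasPrincipalQuotient (EG : Type*) {G V : Type*} [NormedAddCommGroup EG] [NormedSpace ℝ EG]
    [Group G] [TopologicalSpace G] [ChartedSpace EG G] [LieGroup 𝓘(ℝ, EG) ∞ G]
    [NormedAddCommGroup V] [NormedSpace ℝ V] [MulAction G V]
    (N : SubMulAction G V) (hN : IsOpen (N : Set V)) : Prop :=
  letI : ChartedSpace V N :=
    inferInstanceAs (ChartedSpace V (⟨N, hN⟩ : TopologicalSpace.Opens V))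
  T2Space N.Moduli ∧ SecondCountableTopology N.Moduli ∧
  ∃ (d : ℕ) (_ : ChartedSpace (EuclideanSpace ℝ (Fin d)) N.Moduli),
    IsManifold (𝓡 d) ∞ N.Moduli ∧
    IsSmoothPrincipalBundle EG V (EuclideanSpace ℝ (Fin d)) G
      (Quotient.mk (MulAction.orbitRel G N)) ∧
    ∀ (U : Set N.Moduli) (f : N.Moduli → ℝ), IsOpen U →
      (ContMDiffOn (𝓡 d) 𝓘(ℝ, ℝ) ∞ f U ↔
        ContMDiffOn 𝓘(ℝ, V) 𝓘(ℝ, ℝ) ∞ (fun x : N => f (Quotient.mk _ x)) (Quotient.mk _ ⁻¹' U))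

end

/-!
A linear map carrying one definite quadratic form to another is bounded in terms of the two forms,
and so is its inverse. Since the symmetric Ricci tensor transforms as a quadratic form, this makes
the action on the Christoffel symbols with definite Ricci tensor proper.

For any proper smooth action of a Lie group, a complement to the tangent space of the orbit through
a point `x` with trivial isotropy exponentiates to a slice `s`, for which `(g, f) ↦ g • s f` is a
diffeomorphism onto an open set: it is a local diffeomorphism by the inverse function theorem, and
properness makes it injective after shrinking. The slices are the charts of the orbit space and
trivialize the projection to it.

Trivial isotropy is generic because `Γ` determines polynomially, and equivariantly under the
transformations of determinant `± 1`, a sequence of vectors of `ℝ^m`. A transformation fixing `Γ`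
has determinant `± 1`, as it fixes a nondegenerate form, so it fixes these vectors, and is the
identity when they form a basis. It remains to exhibit one torsion free `Γ` for which they do.
-/

/-! ### The inverse function theorem on manifolds -/

section InverseFunction

variable {𝕜 : Type*} [RCLike 𝕜] {E : Type*} [NormedAddCommGroup E] [NormedSpace 𝕜 E]
  {F : Type*} [NormedAddCommGroup F] [NormedSpace 𝕜 F] {n : WithTop ℕ∞}

theorem exists_partialDiffeomorph_of_isInvertible_fderiv [CompleteSpace E]
    {f : E → F} {U : Set E} {x : E}
    (hU : IsOpen U) (hx : x ∈ U) (hf : ContDiffOn 𝕜 n f U) (hn : n ≠ 0)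
    (hf' : (fderiv 𝕜 f x).IsInvertible) :
    ∃ Φ : PartialDiffeomorph 𝓘(𝕜, E) 𝓘(𝕜, F) E F n,
      x ∈ Φ.source ∧ Φ.source ⊆ U ∧ (Φ : E → F) = f := by
  have smooth {y : E} (hy : y ∈ U) : ContDiffAt 𝕜 n f y := hf.contDiffAt (hU.mem_nhds hy)
  have hV : IsOpen (U ∩ fderiv 𝕜 f ⁻¹' {A | A.IsInvertible}) :=
    (hf.continuousOn_fderiv_of_isOpen hU
      (ENat.one_le_iff_ne_zero_withTop.2 hn)).isOpen_inter_preimage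
      hU ContinuousLinearEquiv.isOpen
  obtain ⟨A, hA⟩ := hf'
  have hderiv : HasFDerivAt f (A : E →L[𝕜] F) x :=
    hA ▸ ((smooth hx).differentiableAt hn).hasFDerivAt
  let φ := ((smooth hx).toOpenPartialHomeomorph f hderiv hn).restrOpen _ hV
  refine ⟨⟨φ.toPartialEquiv, φ.open_source, φ.open_target, ?_, ?_⟩,
    ⟨(smooth hx).mem_toOpenPartialHomeomorph_source hderiv hn, hx, A, hA⟩,
    fun y hy => hy.2.1, rfl⟩
  · exact contMDiffOn_iff_contDiffOn.2 (hf.mono fun y hy => hy.2.1)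
  · refine contMDiffOn_iff_contDiffOn.2 fun z hz => ContDiffAt.contDiffWithinAt ?_
    obtain ⟨-, hyU, B, hB⟩ := φ.map_target hz
    refine φ.contDiffAt_symm (f₀' := B) hz ?_ (smooth hyU)
    exact hB ▸ ((smooth hyU).differentiableAt hn).hasFDerivAt

variable {H : Type*} [TopologicalSpace H] {I : ModelWithCorners 𝕜 E H} [I.Boundaryless]
  {H' : Type*} [TopologicalSpace H'] {J : ModelWithCorners 𝕜 F H'} [J.Boundaryless]
  {M : Type*} [TopologicalSpace M] [ChartedSpace H M] [IsManifold I n M]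
  {N : Type*} [TopologicalSpace N] [ChartedSpace H' N] [IsManifold J n N]

variable (n) in
/-- The preferred chart at a point, as a partial diffeomorphism to the model vector space. -/
def extChartPartialDiffeomorph (x : M) : PartialDiffeomorph I 𝓘(𝕜, E) M E n where
  toPartialEquiv := extChartAt I x
  open_source := isOpen_extChartAt_source x
  open_target := isOpen_extChartAt_target x
  contMDiffOn_toFun := extChartAt_source I x ▸ contMDiffOn_extChartAt
  contMDiffOn_invFun := contMDiffOn_extChartAt_symm x

theorem isLocalDiffeomorphAt_of_isInvertible_mfderiv [CompleteSpace E] {f : M → N} {U : Set M}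
    {x : M} (hU : IsOpen U) (hx : x ∈ U) (hf : ContMDiffOn I J n f U) (hn : n ≠ 0)
    (hf' : (mfderiv I J f x).IsInvertible) : IsLocalDiffeomorphAt I J n f x := by
  let g := writtenInExtChartAt I J x f
  let V := U ∩ f ⁻¹' (extChartAt J (f x)).source
  have hV : IsOpen V := hf.continuousOn.isOpen_inter_preimage hU (isOpen_extChartAt_source (f x))
  let W := (extChartAt I x).target ∩ (extChartAt I x).symm ⁻¹' V
  have hW : IsOpen W := (continuousOn_extChartAt_symm x).isOpen_inter_preimage
    (isOpen_extChartAt_target x) hV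
  have hxW : extChartAt I x x ∈ W := by simp [W, V, hx]
  have hg : ContDiffOn 𝕜 n g W := by
    rw [← contMDiffOn_iff_contDiffOn]
    refine contMDiffOn_extChartAt.comp (hf.comp ((contMDiffOn_extChartAt_symm x).mono
      Set.inter_subset_left) fun z hz => hz.2.1) fun z hz => ?_
    exact extChartAt_source J (f x) ▸ hz.2.2
  have hg' : (fderiv 𝕜 g (extChartAt I x x)).IsInvertible := by
    have h : mfderiv I J f x = fderivWithin 𝕜 g (Set.range I) (extChartAt I x x) :=
      ((hf.contMDiffAt (hU.mem_nhds hx)).mdifferentiableAt hn).mfderiv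
    rw [I.range_eq_univ, fderivWithin_univ] at h
    exact h ▸ hf'
  obtain ⟨Φ, hxΦ, hΦW, hΦg⟩ := exists_partialDiffeomorph_of_isInvertible_fderiv hW hxW hg hn hg'
  refine ⟨((extChartPartialDiffeomorph n x).trans Φ).trans
    (extChartPartialDiffeomorph n (f x)).symm, ⟨⟨mem_extChartAt_source x, hxΦ⟩, ?_⟩, ?_⟩
  · change Φ (extChartAt I x x) ∈ (extChartAt J (f x)).target
    rw [hΦg]
    simp [g]
  · rintro z ⟨⟨hz, hzΦ⟩, -⟩
    have hzW : extChartAt I x z ∈ W := hΦW hzΦ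
    have hfz : f z ∈ (extChartAt J (f x)).source := (extChartAt I x).left_inv hz ▸ hzW.2.2
    change f z = (extChartAt J (f x)).symm (Φ (extChartAt I x z))
    simp only [hΦg, g, writtenInExtChartAt, Function.comp_apply, (extChartAt I x).left_inv hz,
      (extChartAt J (f x)).left_inv hfz]

end InverseFunction

/-! ### Orbit maps -/

section OrbitMap

variable {EG : Type*} [NormedAddCommGroup EG] [NormedSpace ℝ EG]
  {HG : Type*} [TopologicalSpace HG] {I : ModelWithCorners ℝ EG HG}
  {EM : Type*} [NormedAddCommGroup EM] [NormedSpace ℝ EM]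
  {HM : Type*} [TopologicalSpace HM] {J : ModelWithCorners ℝ EM HM}
  {G : Type*} [TopologicalSpace G] [ChartedSpace HG G] [Group G]
  {M : Type*} [TopologicalSpace M] [ChartedSpace HM M] [MulAction G M] [ContMDiffSMul I J ∞ G M]

variable (I J) in
theorem contMDiff_orbitMap (x : M) : ContMDiff I J ∞ fun g : G => g • x :=
  contMDiff_id.smul (I := I) (I' := J) contMDiff_const

variable [LieGroup I ∞ G]

theorem mfderiv_orbitMap_mulInvariantVectorField {x : M} {ξ : GroupLieAlgebra I G}
    (hξ : mfderiv I J (fun g : G => g • x) 1 ξ = 0) (g : G) :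
    mfderiv I J (fun h : G => h • x) g (mulInvariantVectorField ξ g) = 0 := by
  have hleft : MDifferentiableAt I I (g * ·) (1 : G) :=
    (contMDiff_mul_left (n := ∞)).mdifferentiable (by simp) 1
  have horbit (h : G) : MDifferentiableAt I J (fun k : G => k • x) h :=
    (contMDiff_orbitMap I J x).mdifferentiable (by simp) h
  have hsmul : MDifferentiableAt J J (g • ·) ((1 : G) • x) :=
    (ContMDiffSMul.contMDiff_const_smul (I := I) (n := ∞) g).mdifferentiable (by simp) _
  have h := congrArg (mfderiv I J · 1 ξ) (funext fun h : G => mul_smul g h x)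
  have h1 := mfderiv_comp_apply (1 : G) (horbit (g * 1)) hleft ξ
  have h2 := mfderiv_comp_apply (1 : G) hsmul (horbit 1) ξ
  rw [hξ, map_zero] at h2
  rw [mul_one] at h1
  exact h1.symm.trans (h.trans h2)

variable [CompleteSpace EG] [I.Boundaryless] [J.Boundaryless] [IsManifold J ∞ M]

/-- An integral curve of a left-invariant field tangent to the stabilizer stays in the
stabilizer. -/
theorem injective_mfderiv_orbitMap {x : M} (hx : ∀ᶠ g : G in 𝓝 1, g • x = x → g = 1) :
    Function.Injective (mfderiv I J (fun g : G => g • x) 1) := by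
  have : LieGroup I (minSmoothness ℝ 3) G := .of_le (n := ∞) (by simpa using ENat.LEInfty.out)
  have : IsManifold I 1 G := .of_le (n := ∞) (by simp)
  have : IsManifold J 1 M := .of_le (n := ∞) (by simp)
  refine (injective_iff_map_eq_zero _).2 fun ξ hξ => ?_
  obtain ⟨γ, hγ0, hγ⟩ := exists_isMIntegralCurveAt_of_contMDiffAt_boundaryless (I := I) (t₀ := 0)
    ((contMDiffAt_mulInvariantVectorField ξ (g := (1 : G))).of_le (by simp))
  have horbit : IsMIntegralCurveAt (I := J) (fun t => γ t • x) (fun _ => 0) 0 := by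
    filter_upwards [hγ] with t ht
    have h := (contMDiff_orbitMap I J x).mdifferentiable (by simp) (γ t) |>.hasMFDerivAt.comp t ht
    refine h.congr_mfderiv (ContinuousLinearMap.ext fun (c : ℝ) => ?_)
    change mfderiv I J (fun g : G => g • x) (γ t) (c • mulInvariantVectorField ξ (γ t)) = c • 0
    rw [map_smul, mfderiv_orbitMap_mulInvariantVectorField hξ]
  have hfixed : (fun t => γ t • x) =ᶠ[𝓝 0] fun _ => x := by
    refine isMIntegralCurveAt_eventuallyEq_of_contMDiffAt_boundaryless
      (Bundle.contMDiff_zeroSection ℝ (TangentSpace J : M → Type _)).contMDiffAt horbit ?_ ?_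
    · refine Eventually.of_forall fun t => (hasMFDerivAt_const x t).congr_mfderiv ?_
      exact ContinuousLinearMap.ext fun (c : ℝ) => (smul_zero c).symm
    · simp only [hγ0, one_smul]
  have hγ1 : γ =ᶠ[𝓝 0] fun _ => 1 := by
    have hγx := hγ.continuousAt.eventually
      (show ∀ᶠ g : G in 𝓝 (γ 0), g • x = x → g = 1 from hγ0.symm ▸ hx)
    filter_upwards [hfixed, hγx] with t h1 h2 using h2 h1
  have hderiv := hasMFDerivAt_unique hγ.hasMFDerivAt
    ((hasMFDerivAt_const (1 : G) (0 : ℝ)).congr_of_eventuallyEq hγ1)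
  have hvalue : mulInvariantVectorField ξ (γ 0) = 0 := by
    exact (one_smul ℝ _).symm.trans (congrArg (fun L => L (1 : ℝ)) hderiv)
  have hid : HasMFDerivAt I I ((1 : G) * ·) 1 (.id ℝ (TangentSpace I (1 : G))) :=
    (hasMFDerivAt_id 1).congr_of_eventuallyEq (.of_forall one_mul)
  rw [hγ0] at hvalue
  exact (DFunLike.congr_fun hid.mfderiv ξ).symm.trans hvalue

end OrbitMap

/-! ### Slices -/

section Complement

/-- The Euclidean space of dimension `dim F - dim E`, a model for the complements of a subspace
isomorphic to `E` in `F`. -/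
abbrev ComplementModel (E F : Type*) [NormedAddCommGroup E] [NormedSpace ℝ E]
    [NormedAddCommGroup F] [NormedSpace ℝ F] : Type :=
  EuclideanSpace ℝ (Fin (Module.finrank ℝ F - Module.finrank ℝ E))

theorem exists_coprod_isInvertible {E F : Type*} [NormedAddCommGroup E] [NormedSpace ℝ E]
    [FiniteDimensional ℝ E] [NormedAddCommGroup F] [NormedSpace ℝ F] [FiniteDimensional ℝ F]
    (A : E →L[ℝ] F) (hA : Function.Injective A) :
    ∃ ι : ComplementModel E F →L[ℝ] F, (A.coprod ι).IsInvertible := by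
  obtain ⟨C, hC⟩ := Submodule.exists_isCompl (LinearMap.range (A : E →ₗ[ℝ] F))
  have hdim : Module.finrank ℝ (ComplementModel E F) = Module.finrank ℝ C := by
    rw [finrank_euclideanSpace_fin, ← Submodule.finrank_add_eq_of_isCompl hC,
      LinearMap.finrank_range_of_inj hA, Nat.add_sub_cancel_left]
  let e := LinearEquiv.ofFinrankEq _ _ hdim
  let ι := C.subtype ∘ₗ e.toLinearMap
  have hrange : LinearMap.range ι = C := by
    rw [LinearMap.range_comp, LinearEquiv.range, Submodule.map_top, Submodule.range_subtype]
  have hinj : Function.Injective ι := C.injective_subtype.comp e.injective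
  have hbij : Function.Bijective ((A : E →ₗ[ℝ] F).coprod ι) := by
    constructor
    · rw [← LinearMap.ker_eq_bot, LinearMap.ker_coprod_of_disjoint_range _ _ (hrange ▸ hC.disjoint),
        LinearMap.ker_eq_bot.2 hinj, LinearMap.ker_eq_bot.2 hA, Submodule.prod_bot]
    · rw [← LinearMap.range_eq_top, LinearMap.range_coprod, hrange, hC.sup_eq_top]
  refine ⟨LinearMap.toContinuousLinearMap ι,
    (LinearEquiv.ofBijective _ hbij).toContinuousLinearEquiv, ?_⟩
  ext x <;> rfl

end Complement

section LocalDiffeomorph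

variable {𝕜 : Type*} [NontriviallyNormedField 𝕜] {n : ℕ∞ω}
  {E : Type*} [NormedAddCommGroup E] [NormedSpace 𝕜 E]
  {H : Type*} [TopologicalSpace H] {I : ModelWithCorners 𝕜 E H}
  {F : Type*} [NormedAddCommGroup F] [NormedSpace 𝕜 F]
  {H' : Type*} [TopologicalSpace H'] {J : ModelWithCorners 𝕜 F H'}
  {M : Type*} [TopologicalSpace M] [ChartedSpace H M]
  {N : Type*} [TopologicalSpace N] [ChartedSpace H' N]

theorem eventually_isLocalDiffeomorphAt {f : M → N} {x : M} (hf : IsLocalDiffeomorphAt I J n f x) :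
    ∀ᶠ y in 𝓝 x, IsLocalDiffeomorphAt I J n f y := by
  obtain ⟨Φ, hx, hΦ⟩ := hf
  filter_upwards [Φ.open_source.mem_nhds hx] with y hy using ⟨Φ, hy, hΦ⟩

theorem exists_injOn_of_isLocalDiffeomorphAt {f : M → N} {x : M}
    (hf : IsLocalDiffeomorphAt I J n f x) : ∃ U ∈ 𝓝 x, Set.InjOn f U := by
  obtain ⟨Φ, hx, hΦ⟩ := hf
  exact ⟨Φ.source, Φ.open_source.mem_nhds hx, Φ.injOn.congr hΦ.symm⟩

variable {E₁ : Type*} [NormedAddCommGroup E₁] [NormedSpace 𝕜 E₁]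
  {H₁ : Type*} [TopologicalSpace H₁] {I₁ : ModelWithCorners 𝕜 E₁ H₁}
  {F₁ : Type*} [NormedAddCommGroup F₁] [NormedSpace 𝕜 F₁]
  {H₁' : Type*} [TopologicalSpace H₁'] {J₁ : ModelWithCorners 𝕜 F₁ H₁'}
  {M₁ : Type*} [TopologicalSpace M₁] [ChartedSpace H₁ M₁]
  {N₁ : Type*} [TopologicalSpace N₁] [ChartedSpace H₁' N₁]

theorem isLocalDiffeomorphAt_prodMap {f : M → N} {f₁ : M₁ → N₁} {p : M × M₁}
    (hf : IsLocalDiffeomorphAt I J n f p.1) (hf₁ : IsLocalDiffeomorphAt I₁ J₁ n f₁ p.2) :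
    IsLocalDiffeomorphAt (I.prod I₁) (J.prod J₁) n (Prod.map f f₁) p := by
  obtain ⟨Φ, hp, hΦ⟩ := hf
  obtain ⟨Ψ, hp₁, hΨ⟩ := hf₁
  refine ⟨⟨Φ.toPartialEquiv.prod Ψ.toPartialEquiv, Φ.open_source.prod Ψ.open_source,
    Φ.open_target.prod Ψ.open_target, ?_, ?_⟩, ⟨hp, hp₁⟩,
    fun q hq => Prod.ext (hΦ hq.1) (hΨ hq.2)⟩
  · exact Φ.contMDiffOn_toFun.prodMap Ψ.contMDiffOn_toFun
  · exact Φ.contMDiffOn_invFun.prodMap Ψ.contMDiffOn_invFun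

theorem isLocalDiffeomorph_univBall {n : ℕ∞} {E : Type*} [NormedAddCommGroup E]
    [InnerProductSpace ℝ E] (c : E) {r : ℝ} (hr : 0 < r) :
    IsLocalDiffeomorph 𝓘(ℝ, E) 𝓘(ℝ, E) n (OpenPartialHomeomorph.univBall c r) := fun x => by
  let φ := OpenPartialHomeomorph.univBall c r
  refine ⟨⟨φ.toPartialEquiv, φ.open_source, φ.open_target, ?_, ?_⟩, ?_, fun _ _ => rfl⟩
  · exact (OpenPartialHomeomorph.contDiff_univBall (E := E)).contMDiff.contMDiffOn
  · have h := OpenPartialHomeomorph.contDiffOn_univBall_symm (n := n) (c := c) (r := r)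
    rw [← OpenPartialHomeomorph.univBall_target c hr] at h
    exact h.contMDiffOn
  · change x ∈ φ.source
    rw [OpenPartialHomeomorph.univBall_source]
    trivial

end LocalDiffeomorph

/-- Otherwise the group elements witnessing the failure over smaller and smaller neighbourhoods of
`y₀` subconverge by properness to an element of the stabilizer of `s y₀`, hence to `1`, which
contradicts the injectivity on `A`. -/
theorem IsProperAction.exists_injOn_univ_prod {G X Y : Type*} [Group G] [TopologicalSpace G]
    [TopologicalSpace X] [T2Space X] [MulAction G X] [ContinuousSMul G X] [TopologicalSpace Y]
    [FirstCountableTopology Y] (hproper : IsProperAction G X) {s : Y → X} {y₀ : Y}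
    (hs : ContinuousAt s y₀) (hstab : MulAction.stabilizer G (s y₀) = ⊥) {A : Set (G × Y)}
    (hA : A ∈ 𝓝 (1, y₀)) (hinj : Set.InjOn (fun p : G × Y => p.1 • s p.2) A) :
    ∃ U ∈ 𝓝 y₀, Set.InjOn (fun p : G × Y => p.1 • s p.2) (Set.univ ×ˢ U) := by
  have hsep : ∀ᶠ p in 𝓝 (y₀, y₀), ∀ g : G, g • s p.1 = s p.2 → (g, p.1) = (1, p.2) := by
    by_contra hcon
    obtain ⟨p, hp, hbad⟩ := exists_seq_forall_of_frequently (not_eventually.1 hcon)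
    simp only [not_forall] at hbad
    choose g hg hne using hbad
    have hp1 : Tendsto (fun n => (p n).1) atTop (𝓝 y₀) := (continuous_fst.tendsto _).comp hp
    have hp2 : Tendsto (fun n => (p n).2) atTop (𝓝 y₀) := (continuous_snd.tendsto _).comp hp
    have hgs : Tendsto (fun n => g n • s (p n).1) atTop (𝓝 (s y₀)) :=
      (hs.tendsto.comp hp2).congr fun n => (hg n).symm
    obtain ⟨φ, k, hφ, hk⟩ := hproper _ g _ _ (hs.tendsto.comp hp1) hgs
    have hks : k • s y₀ = s y₀ := tendsto_nhds_unique
      (hk.smul ((hs.tendsto.comp hp1).comp hφ.tendsto_atTop)) (hgs.comp hφ.tendsto_atTop)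
    obtain rfl : k = 1 := (Subgroup.eq_bot_iff_forall _).1 hstab k hks
    obtain ⟨n, hn1, hn2⟩ := ((hk.prodMk_nhds (hp1.comp hφ.tendsto_atTop)).eventually hA |>.and
      ((tendsto_const_nhds.prodMk_nhds (hp2.comp hφ.tendsto_atTop)).eventually hA)).exists
    exact hne (φ n) (hinj hn1 hn2 ((hg (φ n)).trans (one_smul G _).symm))
  rw [nhds_prod_eq] at hsep
  obtain ⟨U, hU, hsepU⟩ := eventually_prod_self_iff'.1 hsep
  refine ⟨U, hU, fun p hp q hq hpq => ?_⟩
  have hmove : (q.1⁻¹ * p.1) • s p.2 = s q.2 := by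
    rw [mul_smul, inv_smul_eq_iff]
    exact hpq
  obtain ⟨h1, h2⟩ := Prod.mk.inj (hsepU p.2 hp.2 q.2 hq.2 _ hmove)
  exact Prod.ext (inv_mul_eq_one.1 h1).symm h2

section ChartAffine

variable {EN EB : Type*} [NormedAddCommGroup EN] [NormedSpace ℝ EN] [NormedAddCommGroup EB]
  [NormedSpace ℝ EB] {N : Type*} [TopologicalSpace N] [ChartedSpace EN N]

/-- The map `f ↦ x + ι f`, read in the preferred chart at `x`. -/
noncomputable def chartAffine (x : N) (ι : EB →L[ℝ] EN) (f : EB) : N :=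
  (extChartAt 𝓘(ℝ, EN) x).symm (extChartAt 𝓘(ℝ, EN) x x + ι f)

theorem chartAffine_zero (x : N) (ι : EB →L[ℝ] EN) : chartAffine x ι 0 = x := by
  rw [chartAffine, map_zero, add_zero, extChartAt_to_inv]

variable [IsManifold 𝓘(ℝ, EN) ∞ N]

theorem exists_isOpen_contMDiffOn_chartAffine (x : N) (ι : EB →L[ℝ] EN) :
    ∃ V : Set EB, IsOpen V ∧ 0 ∈ V ∧ ContMDiffOn 𝓘(ℝ, EB) 𝓘(ℝ, EN) ∞ (chartAffine x ι) V := by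
  have hι : ContDiff ℝ ∞ fun f => extChartAt 𝓘(ℝ, EN) x x + ι f := by fun_prop
  refine ⟨_, (isOpen_extChartAt_target (I := 𝓘(ℝ, EN)) x).preimage hι.continuous, ?_,
    (contMDiffOn_extChartAt_symm x).comp hι.contMDiff.contMDiffOn fun _ hf => hf⟩
  rw [Set.mem_preimage, map_zero, add_zero]
  exact mem_extChartAt_target x

theorem mfderiv_chartAffine (x : N) (ι : EB →L[ℝ] EN) :
    mfderiv 𝓘(ℝ, EB) 𝓘(ℝ, EN) (chartAffine x ι) 0 = ι := by
  obtain ⟨V, hV, hV0, hs⟩ := exists_isOpen_contMDiffOn_chartAffine x ι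
  have hcont : ContinuousAt (fun f => extChartAt 𝓘(ℝ, EN) x x + ι f) 0 := by fun_prop
  have hmem : extChartAt 𝓘(ℝ, EN) x x + ι 0 ∈ (extChartAt 𝓘(ℝ, EN) x).target := by
    rw [map_zero, add_zero]
    exact mem_extChartAt_target x
  have hchart : writtenInExtChartAt 𝓘(ℝ, EB) 𝓘(ℝ, EN) 0 (chartAffine x ι) =ᶠ[𝓝 0]
      fun f => extChartAt 𝓘(ℝ, EN) x x + ι f := by
    filter_upwards [hcont.eventually ((isOpen_extChartAt_target x).mem_nhds hmem)] with f hf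
    simp only [writtenInExtChartAt, chartAffine_zero]
    exact (extChartAt 𝓘(ℝ, EN) x).right_inv hf
  have h : mfderiv 𝓘(ℝ, EB) 𝓘(ℝ, EN) (chartAffine x ι) 0 = fderivWithin ℝ
      (writtenInExtChartAt 𝓘(ℝ, EB) 𝓘(ℝ, EN) 0 (chartAffine x ι)) (Set.range 𝓘(ℝ, EB)) 0 :=
    ((hs.contMDiffAt (hV.mem_nhds hV0)).mdifferentiableAt (by simp)).mfderiv
  rw [ModelWithCorners.range_eq_univ, fderivWithin_univ, hchart.fderiv_eq, fderiv_const_add,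
    ContinuousLinearMap.fderiv] at h
  exact h

end ChartAffine

section Slice

variable {EG EN EB : Type*} [NormedAddCommGroup EG] [NormedSpace ℝ EG]
  [NormedAddCommGroup EN] [NormedSpace ℝ EN] [NormedAddCommGroup EB] [NormedSpace ℝ EB]
  {G : Type*} [TopologicalSpace G] [ChartedSpace EG G] [Group G]
  {N : Type*} [TopologicalSpace N] [ChartedSpace EN N] [MulAction G N]

variable (EG EN G) in
/-- A global parametrization `s : EB → N` of a slice for a smooth action: `(g, f) ↦ g • s f` is a
diffeomorphism of `G × EB` onto an open subset of `N`. -/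
structure IsSlice (s : EB → N) : Prop where
  injective : Function.Injective fun p : G × EB => p.1 • s p.2
  isLocalDiffeomorph : IsLocalDiffeomorph (𝓘(ℝ, EG).prod 𝓘(ℝ, EB)) 𝓘(ℝ, EN) ∞
    fun p : G × EB => p.1 • s p.2

variable [ContMDiffSMul 𝓘(ℝ, EG) 𝓘(ℝ, EN) ∞ G N]

theorem mfderiv_smul_prod_one {s : EB → N} {f : EB} {x : N}
    (hs : ContMDiffAt 𝓘(ℝ, EB) 𝓘(ℝ, EN) ∞ s f) (hx : s f = x) :
    mfderiv (𝓘(ℝ, EG).prod 𝓘(ℝ, EB)) 𝓘(ℝ, EN) (fun p : G × EB => p.1 • s p.2) (1, f) =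
      ContinuousLinearMap.coprod
        (mfderiv 𝓘(ℝ, EG) 𝓘(ℝ, EN) (fun g : G => g • x) 1 : EG →L[ℝ] EN)
        (mfderiv 𝓘(ℝ, EB) 𝓘(ℝ, EN) s f : EB →L[ℝ] EN) := by
  subst hx
  have hΦ : ContMDiffAt (𝓘(ℝ, EG).prod 𝓘(ℝ, EB)) 𝓘(ℝ, EN) ∞
      (fun p : G × EB => p.1 • s p.2) (1, f) :=
    contMDiffAt_fst.smul (hs.comp (1, f) contMDiffAt_snd)
  let A : EG →L[ℝ] EN := mfderiv 𝓘(ℝ, EG) 𝓘(ℝ, EN) (fun g : G => g • s f) 1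
  let D (t : EB → N) : EB →L[ℝ] EN := mfderiv 𝓘(ℝ, EB) 𝓘(ℝ, EN) t f
  have hone : (fun f => (1 : G) • s f) = s := funext fun f => one_smul G (s f)
  refine ContinuousLinearMap.ext fun v => ?_
  rw [mfderiv_prod_eq_add_apply (hΦ.mdifferentiableAt (by simp))]
  exact congrArg (fun t => A v.1 + D t v.2) hone

variable [LieGroup 𝓘(ℝ, EG) ∞ G]

theorem isLocalDiffeomorphAt_smul_of_one {s : EB → N} {f : EB}
    (hs : IsLocalDiffeomorphAt (𝓘(ℝ, EG).prod 𝓘(ℝ, EB)) 𝓘(ℝ, EN) ∞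
      (fun p : G × EB => p.1 • s p.2) (1, f)) (g : G) :
    IsLocalDiffeomorphAt (𝓘(ℝ, EG).prod 𝓘(ℝ, EB)) 𝓘(ℝ, EN) ∞
      (fun p : G × EB => p.1 • s p.2) (g, f) := by
  have hmul : IsLocalDiffeomorphAt 𝓘(ℝ, EG) 𝓘(ℝ, EG) ∞ (g⁻¹ • · : G → G) g :=
    (Diffeomorph.smul 𝓘(ℝ, EG) 𝓘(ℝ, EG) ∞ g⁻¹).isLocalDiffeomorph g
  have hsmul : IsLocalDiffeomorph 𝓘(ℝ, EN) 𝓘(ℝ, EN) ∞ (g • · : N → N) :=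
    (Diffeomorph.smul 𝓘(ℝ, EG) 𝓘(ℝ, EN) ∞ g).isLocalDiffeomorph
  have hprod := isLocalDiffeomorphAt_prodMap (p := (g, f)) hmul
    ((Diffeomorph.refl 𝓘(ℝ, EB) EB ∞).isLocalDiffeomorph f)
  have hbase : (Prod.map (g⁻¹ • ·) (Diffeomorph.refl 𝓘(ℝ, EB) EB ∞) (g, f) : G × EB) = (1, f) :=
    Prod.ext (inv_mul_cancel g) rfl
  convert (hprod.comp _ _ (hbase.symm ▸ hs)).comp _ _ (hsmul _) using 1
  funext p
  change p.1 • s p.2 = g • (g⁻¹ * p.1) • s p.2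
  rw [smul_smul, mul_inv_cancel_left]

variable [FiniteDimensional ℝ EG] [FiniteDimensional ℝ EN] [IsManifold 𝓘(ℝ, EN) ∞ N]

/-- The slice is a complement, in the chart at `x`, of the tangent space of the orbit. -/
theorem exists_isLocalDiffeomorphAt_smul {x : N} (hx : MulAction.stabilizer G x = ⊥) :
    ∃ s : ComplementModel EG EN → N, s 0 = x ∧
      IsLocalDiffeomorphAt (𝓘(ℝ, EG).prod 𝓘(ℝ, ComplementModel EG EN)) 𝓘(ℝ, EN) ∞
        (fun p : G × ComplementModel EG EN => p.1 • s p.2) (1, 0) := by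
  have hfree : ∀ᶠ g : G in 𝓝 1, g • x = x → g = 1 :=
    .of_forall ((Subgroup.eq_bot_iff_forall _).1 hx)
  obtain ⟨ι, hι⟩ := exists_coprod_isInvertible (E := EG) (F := EN) _
    (injective_mfderiv_orbitMap (I := 𝓘(ℝ, EG)) (J := 𝓘(ℝ, EN)) hfree)
  obtain ⟨V, hV, hV0, hs⟩ := exists_isOpen_contMDiffOn_chartAffine x ι
  have hΦ : ContMDiffOn (𝓘(ℝ, EG).prod 𝓘(ℝ, ComplementModel EG EN)) 𝓘(ℝ, EN) ∞
      (fun p : G × ComplementModel EG EN => p.1 • chartAffine x ι p.2) (Set.univ ×ˢ V) :=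
    contMDiffOn_fst.smul (hs.comp contMDiffOn_snd fun p hp => hp.2)
  refine ⟨chartAffine x ι, chartAffine_zero x ι,
    isLocalDiffeomorphAt_of_isInvertible_mfderiv (isOpen_univ.prod hV) ⟨trivial, hV0⟩ hΦ
      (by simp) ?_⟩
  rw [mfderiv_smul_prod_one (hs.contMDiffAt (hV.mem_nhds hV0)) (chartAffine_zero x ι),
    mfderiv_chartAffine]
  exact hι

theorem exists_isSlice [T2Space N] (hproper : IsProperAction G N) {x : N}
    (hx : MulAction.stabilizer G x = ⊥) :
    ∃ s : ComplementModel EG EN → N, s 0 = x ∧ IsSlice EG EN G s := by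
  obtain ⟨s, hs0, hs⟩ := exists_isLocalDiffeomorphAt_smul (EG := EG) (EN := EN) hx
  have : ContinuousSMul G N := ContMDiffSMul.continuousSMul (I := 𝓘(ℝ, EG)) (I' := 𝓘(ℝ, EN)) ∞
  have hcont : ContinuousAt s 0 := by
    have h := hs.contMDiffAt.continuousAt.comp (Continuous.prodMk_right (1 : G)).continuousAt
    exact h.congr (.of_forall fun f => one_smul G (s f))
  obtain ⟨A, hA, hinj⟩ := exists_injOn_of_isLocalDiffeomorphAt hs
  obtain ⟨U, hU, hinjU⟩ := hproper.exists_injOn_univ_prod hcont (hs0 ▸ hx) hA hinj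
  have hnear : ∀ᶠ f in 𝓝 0, f ∈ U ∧ IsLocalDiffeomorphAt
      (𝓘(ℝ, EG).prod 𝓘(ℝ, ComplementModel EG EN)) 𝓘(ℝ, EN) ∞
      (fun p : G × ComplementModel EG EN => p.1 • s p.2) (1, f) :=
    Filter.Eventually.and hU ((Continuous.prodMk_right (1 : G)).continuousAt.eventually
      (eventually_isLocalDiffeomorphAt hs))
  obtain ⟨r, hr, hball⟩ := Metric.eventually_nhds_iff_ball.1 hnear
  let b := OpenPartialHomeomorph.univBall (0 : ComplementModel EG EN) r
  have hb (f : ComplementModel EG EN) : b f ∈ Metric.ball 0 r := by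
    rw [← OpenPartialHomeomorph.univBall_target (0 : ComplementModel EG EN) hr]
    refine b.map_source ?_
    rw [OpenPartialHomeomorph.univBall_source]
    exact Set.mem_univ f
  have hbinj : Function.Injective b := by
    rw [← Set.injOn_univ, ← OpenPartialHomeomorph.univBall_source (0 : ComplementModel EG EN) r]
    exact b.injOn
  refine ⟨s ∘ b, ?_, fun p q hpq => ?_, fun p => ?_⟩
  · rw [Function.comp_apply, OpenPartialHomeomorph.univBall_apply_zero, hs0]
  · have h := @hinjU (p.1, b p.2) ⟨trivial, (hball _ (hb p.2)).1⟩ (q.1, b q.2)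
      ⟨trivial, (hball _ (hb q.2)).1⟩ hpq
    exact Prod.ext (Prod.mk.inj h).1 (hbinj (Prod.mk.inj h).2)
  · have hsweep := isLocalDiffeomorphAt_smul_of_one (hball _ (hb p.2)).2 p.1
    have hprod := isLocalDiffeomorphAt_prodMap
      ((Diffeomorph.refl 𝓘(ℝ, EG) G ∞).isLocalDiffeomorph p.1)
      (isLocalDiffeomorph_univBall (n := ⊤) (0 : ComplementModel EG EN) hr p.2)
    exact hprod.comp _ _ hsweep

end Slice

/-! ### The orbit space of a free proper action -/

section LocalDiffeomorph

variable {𝕜 : Type*} [NontriviallyNormedField 𝕜] {n : ℕ∞ω}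
  {E : Type*} [NormedAddCommGroup E] [NormedSpace 𝕜 E]
  {H : Type*} [TopologicalSpace H] {I : ModelWithCorners 𝕜 E H}
  {F : Type*} [NormedAddCommGroup F] [NormedSpace 𝕜 F]
  {H' : Type*} [TopologicalSpace H'] {J : ModelWithCorners 𝕜 F H'}
  {M : Type*} [TopologicalSpace M] [ChartedSpace H M]
  {N : Type*} [TopologicalSpace N] [ChartedSpace H' N] {f : M → N}

theorem isOpenEmbedding_of_isLocalDiffeomorph (hf : IsLocalDiffeomorph I J n f)
    (hinj : Function.Injective f) : IsOpenEmbedding f :=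
  .of_continuous_injective_isOpenMap hf.contMDiff.continuous hinj hf.isOpenMap

theorem contMDiffOn_symm_of_isLocalDiffeomorph [Nonempty M] (hf : IsLocalDiffeomorph I J n f)
    (hemb : IsOpenEmbedding f) :
    ContMDiffOn J I n (hemb.toOpenPartialHomeomorph f).symm (Set.range f) := by
  rintro _ ⟨x, rfl⟩
  refine ((hf x).localInverse_contMDiffAt.congr_of_eventuallyEq ?_).contMDiffWithinAt
  filter_upwards [(hf x).localInverse_eventuallyEq_right] with y hy
  refine hemb.injective ((hemb.toOpenPartialHomeomorph_right_inv f ?_).trans hy.symm)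
  exact ⟨_, hy⟩

end LocalDiffeomorph

section OrbitSpace

variable {G X : Type*} [Group G] [MulAction G X]

theorem mk_orbitRel_eq_iff {x y : X} :
    Quotient.mk (MulAction.orbitRel G X) x = Quotient.mk (MulAction.orbitRel G X) y ↔
      ∃ g : G, g • x = y := by
  rw [eq_comm, Quotient.eq, MulAction.orbitRel_apply]
  rfl

theorem mk_orbitRel_smul (g : G) (x : X) :
    Quotient.mk (MulAction.orbitRel G X) (g • x) = Quotient.mk (MulAction.orbitRel G X) x :=
  (mk_orbitRel_eq_iff.2 ⟨g, rfl⟩).symm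

end OrbitSpace

namespace IsSlice

variable {EG EN EB : Type*} [NormedAddCommGroup EG] [NormedSpace ℝ EG]
  [NormedAddCommGroup EN] [NormedSpace ℝ EN] [NormedAddCommGroup EB] [NormedSpace ℝ EB]
  {G : Type*} [TopologicalSpace G] [ChartedSpace EG G] [Group G]
  {N : Type*} [TopologicalSpace N] [ChartedSpace EN N] [MulAction G N] {s : EB → N}

local notation "π" => Quotient.mk (MulAction.orbitRel G N)

/-- The tube around a slice `s`: the identification `(g, f) ↦ g • s f` of `G × EB` with the union of
the orbits through the slice. -/
noncomputable def tube (hs : IsSlice EG EN G s) : OpenPartialHomeomorph (G × EB) N :=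
  (isOpenEmbedding_of_isLocalDiffeomorph hs.isLocalDiffeomorph
    hs.injective).toOpenPartialHomeomorph _

variable (hs : IsSlice EG EN G s)
include hs

theorem stabilizer_slice_eq_bot (f : EB) : MulAction.stabilizer G (s f) = ⊥ := by
  refine (Subgroup.eq_bot_iff_forall _).2 fun g hg => ?_
  exact (Prod.mk.inj (@hs.injective (g, f) (1, f) (hg.trans (one_smul G _).symm))).1

theorem contMDiff_slice : ContMDiff 𝓘(ℝ, EB) 𝓘(ℝ, EN) ∞ s := by
  have h := hs.isLocalDiffeomorph.contMDiff.comp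
    (contMDiff_const.prodMk contMDiff_id : ContMDiff 𝓘(ℝ, EB) _ _ fun f => ((1 : G), f))
  exact h.congr fun f => (one_smul G (s f)).symm

theorem tube_apply (p : G × EB) : hs.tube p = p.1 • s p.2 := rfl

theorem tube_source : hs.tube.source = Set.univ := rfl

theorem tube_target : hs.tube.target = Set.range fun p : G × EB => p.1 • s p.2 :=
  IsOpenEmbedding.toOpenPartialHomeomorph_target _ _

theorem tube_mem_target (p : G × EB) : hs.tube p ∈ hs.tube.target :=
  hs.tube.map_source (Set.mem_univ p)

theorem tube_symm_tube (p : G × EB) : hs.tube.symm (hs.tube p) = p :=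
  hs.tube.left_inv (Set.mem_univ p)

theorem slice_mem_target (f : EB) : s f ∈ hs.tube.target := by
  rw [← one_smul G (s f)]
  exact hs.tube_mem_target (1, f)

theorem mem_target_of_eq {f : EB} {y : N} (h : s f = y) : y ∈ hs.tube.target :=
  h ▸ hs.slice_mem_target f

theorem contMDiffOn_tube_symm : ContMDiffOn 𝓘(ℝ, EN) (𝓘(ℝ, EG).prod 𝓘(ℝ, EB)) ∞
    hs.tube.symm hs.tube.target := by
  rw [tube_target]
  exact contMDiffOn_symm_of_isLocalDiffeomorph hs.isLocalDiffeomorph _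

theorem smul_tube (g : G) (p : G × EB) : g • hs.tube p = hs.tube (g * p.1, p.2) := by
  rw [tube_apply, tube_apply, mul_smul]

theorem tube_symm_smul (g : G) {y : N} (hy : y ∈ hs.tube.target) :
    hs.tube.symm (g • y) = (g * (hs.tube.symm y).1, (hs.tube.symm y).2) := by
  conv_lhs => rw [← hs.tube.right_inv hy, smul_tube, tube_symm_tube]

theorem mk_slice_eq {y : N} (hy : y ∈ hs.tube.target) : π (s (hs.tube.symm y).2) = π y := by
  conv_rhs => rw [← hs.tube.right_inv hy, tube_apply, mk_orbitRel_smul]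

theorem injective_mk_slice : Function.Injective fun f => π (s f) := fun f f' hff' => by
  obtain ⟨g, hg⟩ := mk_orbitRel_eq_iff.1 hff'
  exact (Prod.mk.inj (@hs.injective (g, f) (1, f') (hg.trans (one_smul G _).symm))).2

variable [ContinuousConstSMul G N]

theorem isOpenEmbedding_mk_slice : IsOpenEmbedding fun f => π (s f) := by
  refine .of_continuous_injective_isOpenMap
    (continuous_quotient_mk'.comp hs.contMDiff_slice.continuous) hs.injective_mk_slice
    fun U hU => ?_
  have himage : (fun f => π (s f)) '' U =
      π '' ((fun p : G × EB => p.1 • s p.2) '' Set.univ ×ˢ U) := by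
    refine subset_antisymm ?_ ?_
    · rintro _ ⟨f, hf, rfl⟩
      exact ⟨_, ⟨(1, f), ⟨trivial, hf⟩, rfl⟩, mk_orbitRel_smul 1 (s f)⟩
    · rintro _ ⟨_, ⟨p, hp, rfl⟩, rfl⟩
      exact ⟨p.2, hp.2, (mk_orbitRel_smul p.1 (s p.2)).symm⟩
  rw [himage]
  exact MulAction.isOpenQuotientMap_quotientMk.isOpenMap _
    (hs.isLocalDiffeomorph.isOpenMap _ (isOpen_univ.prod hU))

/-- The chart of the orbit space inverse to the projection of a slice. -/
noncomputable def chart : OpenPartialHomeomorph (Quotient (MulAction.orbitRel G N)) EB :=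
  (hs.isOpenEmbedding_mk_slice.toOpenPartialHomeomorph _).symm

theorem chart_symm_apply (f : EB) : hs.chart.symm f = π (s f) := rfl

theorem chart_source : hs.chart.source = Set.range fun f => π (s f) :=
  hs.isOpenEmbedding_mk_slice.toOpenPartialHomeomorph_target _

theorem chart_target : hs.chart.target = Set.univ := rfl

theorem mk_mem_chart_source_iff {y : N} : π y ∈ hs.chart.source ↔ y ∈ hs.tube.target := by
  rw [chart_source]
  refine ⟨?_, fun hy => ⟨_, hs.mk_slice_eq hy⟩⟩
  rintro ⟨f, hf⟩
  obtain ⟨g, rfl⟩ := mk_orbitRel_eq_iff.1 hf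
  exact hs.tube_mem_target (g, f)

theorem chart_mk {y : N} (hy : y ∈ hs.tube.target) : hs.chart (π y) = (hs.tube.symm y).2 := by
  rw [← hs.mk_slice_eq hy, ← hs.chart_symm_apply, hs.chart.right_inv (Set.mem_univ _)]

theorem contDiffOn_transition {t : EB → N} (ht : IsSlice EG EN G t) :
    ContDiffOn ℝ ∞ (hs.chart.symm ≫ₕ ht.chart) (hs.chart.symm ≫ₕ ht.chart).source := by
  have hmem : ∀ f ∈ (hs.chart.symm ≫ₕ ht.chart).source, s f ∈ ht.tube.target := by
    intro f hf
    rw [OpenPartialHomeomorph.trans_source] at hf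
    exact ht.mk_mem_chart_source_iff.1 hf.2
  have h := (contMDiff_snd (I := 𝓘(ℝ, EG)) (M := G)).comp_contMDiffOn
    (ht.contMDiffOn_tube_symm.comp hs.contMDiff_slice.contMDiffOn hmem)
  exact (h.congr fun f hf => ht.chart_mk (hmem f hf)).contDiffOn

/-- The local trivialization of `π` over the projection of a slice. -/
noncomputable def trivialization : Bundle.Trivialization G π where
  toOpenPartialHomeomorph := hs.tube.symm ≫ₕ (Homeomorph.prodComm G EB).toOpenPartialHomeomorph ≫ₕ
    hs.chart.symm.prod (OpenPartialHomeomorph.refl G)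
  baseSet := hs.chart.source
  open_baseSet := hs.chart.open_source
  source_eq := by
    ext y
    simp [mk_mem_chart_source_iff, chart_target]
  target_eq := by
    ext p
    simp [tube_source]
  proj_toFun y hy := hs.mk_slice_eq hy.1

theorem trivialization_apply {y : N} (hy : y ∈ hs.tube.target) :
    hs.trivialization y = (π y, (hs.tube.symm y).1) :=
  Prod.ext (hs.mk_slice_eq hy) rfl

theorem trivialization_source : hs.trivialization.source = hs.tube.target := by
  ext y
  rw [hs.trivialization.source_eq]
  exact hs.mk_mem_chart_source_iff

section Atlas

variable [ChartedSpace EB (Quotient (MulAction.orbitRel G N))]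
  (hatlas : hs.chart ∈ IsManifold.maximalAtlas 𝓘(ℝ, EB) ∞ (Quotient (MulAction.orbitRel G N)))
include hatlas

theorem contMDiffOn_mk : ContMDiffOn 𝓘(ℝ, EN) 𝓘(ℝ, EB) ∞ π hs.tube.target := by
  have h := (contMDiffOn_symm_of_mem_maximalAtlas hatlas).comp
    ((contMDiff_snd (I := 𝓘(ℝ, EG)) (M := G)).comp_contMDiffOn hs.contMDiffOn_tube_symm)
    fun y _ => Set.mem_univ _
  exact h.congr fun y hy => (hs.mk_slice_eq hy).symm

theorem contMDiffAt_of_comp_mk {F : Type*} [NormedAddCommGroup F] [NormedSpace ℝ F]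
    {h : Quotient (MulAction.orbitRel G N) → F} {y : N} (hy : y ∈ hs.tube.target)
    (hh : ContMDiffAt 𝓘(ℝ, EN) 𝓘(ℝ, F) ∞ (h ∘ π) (s (hs.tube.symm y).2)) :
    ContMDiffAt 𝓘(ℝ, EB) 𝓘(ℝ, F) ∞ h (π y) := by
  have hmem := hs.mk_mem_chart_source_iff.2 hy
  rw [← hs.chart_mk hy] at hh
  have hlift := (hh.comp _ hs.contMDiff_slice.contMDiffAt).comp _
    (contMDiffAt_of_mem_maximalAtlas hatlas hmem)
  refine hlift.congr_of_eventuallyEq ?_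
  filter_upwards [hs.chart.open_source.mem_nhds hmem] with b hb
  exact congrArg h (hs.chart.left_inv hb).symm

theorem contMDiffOn_trivialization : ContMDiffOn 𝓘(ℝ, EN) (𝓘(ℝ, EB).prod 𝓘(ℝ, EG)) ∞
    hs.trivialization hs.tube.target := by
  have hframe := (contMDiff_fst (J := 𝓘(ℝ, EB)) (N := EB)).comp_contMDiffOn hs.contMDiffOn_tube_symm
  exact ((hs.contMDiffOn_mk hatlas).prodMk hframe).congr fun y hy => hs.trivialization_apply hy

theorem contMDiffOn_trivialization_symm [ContMDiffSMul 𝓘(ℝ, EG) 𝓘(ℝ, EN) ∞ G N] :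
    ContMDiffOn (𝓘(ℝ, EB).prod 𝓘(ℝ, EG)) 𝓘(ℝ, EN) ∞
      hs.trivialization.toOpenPartialHomeomorph.symm hs.trivialization.target := by
  have hchart : ContMDiffOn (𝓘(ℝ, EB).prod 𝓘(ℝ, EG)) 𝓘(ℝ, EB) ∞
      (fun p : Quotient (MulAction.orbitRel G N) × G => hs.chart p.1) hs.trivialization.target := by
    rw [hs.trivialization.target_eq]
    exact (contMDiffOn_of_mem_maximalAtlas hatlas).comp contMDiffOn_fst fun p hp => hp.1
  exact contMDiffOn_snd.smul (hs.contMDiff_slice.comp_contMDiffOn hchart)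

end Atlas

end IsSlice

section SliceAtlas

variable {EG EN EB : Type*} [NormedAddCommGroup EG] [NormedSpace ℝ EG]
  [NormedAddCommGroup EN] [NormedSpace ℝ EN] [NormedAddCommGroup EB] [NormedSpace ℝ EB]
  {G : Type*} [TopologicalSpace G] [ChartedSpace EG G] [Group G]
  {N : Type*} [TopologicalSpace N] [ChartedSpace EN N] [MulAction G N]

section SmoothStructure

variable [ContinuousConstSMul G N] (s : N → EB → N) (hs : ∀ x, IsSlice EG EN G (s x))
  (hx : ∀ x, s x 0 = x)

/-- The atlas of the orbit space given by slices through all points. -/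
noncomputable abbrev sliceChartedSpace : ChartedSpace EB (Quotient (MulAction.orbitRel G N)) where
  atlas := Set.range fun x => (hs x).chart
  chartAt b := (hs b.out).chart
  mem_chart_source b := by
    have h := (hs b.out).mk_mem_chart_source_iff.2 ((hs b.out).slice_mem_target 0)
    rwa [hx, Quotient.out_eq] at h
  chart_mem_atlas b := ⟨b.out, rfl⟩

theorem isManifold_sliceChartedSpace :
    letI := sliceChartedSpace s hs hx
    IsManifold 𝓘(ℝ, EB) ∞ (Quotient (MulAction.orbitRel G N)) := by
  let := sliceChartedSpace s hs hx
  refine isManifold_of_contDiffOn _ _ _ ?_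
  rintro _ _ ⟨x, rfl⟩ ⟨y, rfl⟩
  simpa using (hs x).contDiffOn_transition (hs y)

end SmoothStructure

variable [ContinuousConstSMul G N] [ChartedSpace EB (Quotient (MulAction.orbitRel G N))]
  {s : N → EB → N} (hs : ∀ x, IsSlice EG EN G (s x)) (hx : ∀ x, s x 0 = x)
  (hatlas : ∀ x, (hs x).chart ∈
    IsManifold.maximalAtlas 𝓘(ℝ, EB) ∞ (Quotient (MulAction.orbitRel G N)))
include hx hatlas

local notation "π" => Quotient.mk (MulAction.orbitRel G N)

theorem contMDiff_mk_of_isSlice : ContMDiff 𝓘(ℝ, EN) 𝓘(ℝ, EB) ∞ π := fun x =>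
  ((hs x).contMDiffOn_mk (hatlas x)).contMDiffAt
    ((hs x).tube.open_target.mem_nhds ((hs x).mem_target_of_eq (hx x)))

theorem contMDiffOn_iff_comp_mk_of_isSlice {F : Type*} [NormedAddCommGroup F] [NormedSpace ℝ F]
    {U : Set (Quotient (MulAction.orbitRel G N))} (hU : IsOpen U)
    (h : Quotient (MulAction.orbitRel G N) → F) :
    ContMDiffOn 𝓘(ℝ, EB) 𝓘(ℝ, F) ∞ h U ↔
      ContMDiffOn 𝓘(ℝ, EN) 𝓘(ℝ, F) ∞ (fun x => h (π x)) (π ⁻¹' U) := by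
  refine ⟨fun hh => hh.comp (contMDiff_mk_of_isSlice hs hx hatlas).contMDiffOn fun _ hy => hy,
    fun hh b hb => ContMDiffAt.contMDiffWithinAt ?_⟩
  induction b using Quotient.inductionOn with | _ x
  have hmem : x ∈ (hs x).tube.target := (hs x).mem_target_of_eq (hx x)
  refine (hs x).contMDiffAt_of_comp_mk (hatlas x) hmem (hh.contMDiffAt ?_)
  refine (hU.preimage continuous_quotient_mk').mem_nhds ?_
  change π _ ∈ U
  rwa [(hs x).mk_slice_eq hmem]

theorem isSmoothPrincipalBundle_of_isSlice [LieGroup 𝓘(ℝ, EG) ∞ G]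
    [ContMDiffSMul 𝓘(ℝ, EG) 𝓘(ℝ, EN) ∞ G N] :
    IsSmoothPrincipalBundle EG EN EB G π where
  contMDiff_smul := contMDiff_fst.smul contMDiff_snd
  contMDiff_proj := contMDiff_mk_of_isSlice hs hx hatlas
  surjective := Quotient.mk_surjective
  proj_eq_iff _ _ := mk_orbitRel_eq_iff
  exists_trivialization b := by
    induction b using Quotient.inductionOn with | _ x
    have hmem : x ∈ (hs x).tube.target := (hs x).mem_target_of_eq (hx x)
    refine ⟨(hs x).trivialization, (hs x).mk_mem_chart_source_iff.2 hmem, ?_,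
      (hs x).contMDiffOn_trivialization_symm (hatlas x), fun y hy g => ?_⟩
    · rw [(hs x).trivialization_source]
      exact (hs x).contMDiffOn_trivialization (hatlas x)
    · rw [(hs x).trivialization_source] at hy
      have hgy : g • y ∈ (hs x).tube.target := by
        rw [← (hs x).tube.right_inv hy, (hs x).smul_tube]
        exact (hs x).tube_mem_target _
      rw [(hs x).trivialization_apply hgy, (hs x).trivialization_apply hy,
        (hs x).tube_symm_smul g hy, mk_orbitRel_smul]

end SliceAtlas

namespace IsProperAction

theorem t2Space_quotient {G X : Type*} [TopologicalSpace G] [TopologicalSpace X]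
    [Group G] [MulAction G X] [ContinuousSMul G X] [T2Space X] [FirstCountableTopology X]
    (hproper : IsProperAction G X) : T2Space (Quotient (MulAction.orbitRel G X)) := by
  rw [t2Space_iff_of_isOpenQuotientMap MulAction.isOpenQuotientMap_quotientMk]
  refine IsSeqClosed.isClosed fun u p hu hp => ?_
  choose g hg using fun n => mk_orbitRel_eq_iff.1 (hu n)
  have hfst : Tendsto (fun n => (u n).1) atTop (𝓝 p.1) := (continuous_fst.tendsto p).comp hp
  have hsnd : Tendsto (fun n => g n • (u n).1) atTop (𝓝 p.2) := by
    simp only [hg]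
    exact (continuous_snd.tendsto p).comp hp
  obtain ⟨φ, k, hφ, hk⟩ := hproper _ g _ _ hfst hsnd
  exact mk_orbitRel_eq_iff.2 ⟨k, tendsto_nhds_unique (hk.smul (hfst.comp hφ.tendsto_atTop))
    (hsnd.comp hφ.tendsto_atTop)⟩

theorem mono {G X : Type*} [TopologicalSpace G] [TopologicalSpace X] [Group G]
    [MulAction G X] {M N : SubMulAction G X} (hproper : IsProperAction G N) (hMN : M ≤ N) :
    IsProperAction G M := by
  intro x g a b hx hg
  exact hproper (fun n => ⟨x n, hMN (x n).2⟩) g ⟨a, hMN a.2⟩ ⟨b, hMN b.2⟩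
    (tendsto_subtype_rng.2 ((continuous_subtype_val.tendsto a).comp hx))
    (tendsto_subtype_rng.2 ((continuous_subtype_val.tendsto b).comp hg))

end IsProperAction

section QuotientManifold

variable {EG EN : Type*} [NormedAddCommGroup EG] [NormedSpace ℝ EG] [FiniteDimensional ℝ EG]
  [NormedAddCommGroup EN] [NormedSpace ℝ EN] [FiniteDimensional ℝ EN]
  {G : Type*} [TopologicalSpace G] [ChartedSpace EG G] [Group G] [LieGroup 𝓘(ℝ, EG) ∞ G]
  {N : Type*} [TopologicalSpace N] [ChartedSpace EN N] [IsManifold 𝓘(ℝ, EN) ∞ N] [T2Space N]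
  [MulAction G N] [ContMDiffSMul 𝓘(ℝ, EG) 𝓘(ℝ, EN) ∞ G N]

variable (EG EN) in
include EG EN in
theorem isOpen_setOf_stabilizer_eq_bot (hproper : IsProperAction G N) :
    IsOpen {x : N | MulAction.stabilizer G x = ⊥} := by
  refine isOpen_iff_mem_nhds.2 fun x hx => ?_
  obtain ⟨s, hsx, hs⟩ := exists_isSlice (EG := EG) (EN := EN) hproper hx
  filter_upwards [hs.tube.open_target.mem_nhds (hs.mem_target_of_eq hsx)] with y hy
  rw [← hs.tube.right_inv hy, hs.tube_apply,
    MulAction.stabilizer_smul_eq_stabilizer_map_conj, hs.stabilizer_slice_eq_bot, Subgroup.map_bot]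

theorem exists_chartedSpace_isSmoothPrincipalBundle (hproper : IsProperAction G N)
    (hfree : ∀ x : N, MulAction.stabilizer G x = ⊥) :
    ∃ _ : ChartedSpace (ComplementModel EG EN) (Quotient (MulAction.orbitRel G N)),
      IsManifold 𝓘(ℝ, ComplementModel EG EN) ∞ (Quotient (MulAction.orbitRel G N)) ∧
      IsSmoothPrincipalBundle EG EN (ComplementModel EG EN) G
        (Quotient.mk (MulAction.orbitRel G N)) ∧
      ∀ (U : Set (Quotient (MulAction.orbitRel G N)))
        (f : Quotient (MulAction.orbitRel G N) → ℝ), IsOpen U →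
        (ContMDiffOn 𝓘(ℝ, ComplementModel EG EN) 𝓘(ℝ, ℝ) ∞ f U ↔
          ContMDiffOn 𝓘(ℝ, EN) 𝓘(ℝ, ℝ) ∞ (fun x : N => f (Quotient.mk _ x))
            (Quotient.mk _ ⁻¹' U)) := by
  have : ContinuousSMul G N := ContMDiffSMul.continuousSMul (I := 𝓘(ℝ, EG)) (I' := 𝓘(ℝ, EN)) ∞
  choose s hsx hs using fun x => exists_isSlice (EG := EG) (EN := EN) hproper (hfree x)
  let := sliceChartedSpace s hs hsx
  have hmanifold := isManifold_sliceChartedSpace s hs hsx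
  have hatlas (x : N) : (hs x).chart ∈ IsManifold.maximalAtlas 𝓘(ℝ, ComplementModel EG EN) ∞
      (Quotient (MulAction.orbitRel G N)) := IsManifold.subset_maximalAtlas ⟨x, rfl⟩
  exact ⟨sliceChartedSpace s hs hsx, hmanifold,
    isSmoothPrincipalBundle_of_isSlice hs hsx hatlas,
    fun U f hU => contMDiffOn_iff_comp_mk_of_isSlice hs hsx hatlas hU f⟩

end QuotientManifold

section OpenInvariant

variable {EG EX : Type*} [NormedAddCommGroup EG] [NormedSpace ℝ EG]
  [NormedAddCommGroup EX] [NormedSpace ℝ EX]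
  {G : Type*} [Group G]
  {X : Type*} [TopologicalSpace X] [ChartedSpace EX X] [MulAction G X]
  {N : SubMulAction G X} (hN : IsOpen (N : Set X))

/-- The smooth structure of an open invariant subset of a manifold. -/
noncomputable abbrev openChartedSpace : ChartedSpace EX N :=
  inferInstanceAs (ChartedSpace EX (⟨N, hN⟩ : TopologicalSpace.Opens X))

theorem isManifold_openChartedSpace [IsManifold 𝓘(ℝ, EX) ∞ X] :
    letI : ChartedSpace EX N := openChartedSpace hN
    IsManifold 𝓘(ℝ, EX) ∞ N :=
  inferInstanceAs (IsManifold 𝓘(ℝ, EX) ∞ (⟨N, hN⟩ : TopologicalSpace.Opens X))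

theorem contMDiffSMul_openChartedSpace [TopologicalSpace G] [ChartedSpace EG G]
    [ContMDiffSMul 𝓘(ℝ, EG) 𝓘(ℝ, EX) ∞ G X] :
    letI : ChartedSpace EX N := openChartedSpace hN
    ContMDiffSMul 𝓘(ℝ, EG) 𝓘(ℝ, EX) ∞ G N := by
  let : ChartedSpace EX N := openChartedSpace hN
  have hval : ContMDiff 𝓘(ℝ, EX) 𝓘(ℝ, EX) ∞ (Subtype.val : N → X) :=
    contMDiff_subtype_val (U := (⟨N, hN⟩ : TopologicalSpace.Opens X))
  have hsmul : ContMDiff (𝓘(ℝ, EG).prod 𝓘(ℝ, EX)) 𝓘(ℝ, EX) ∞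
      fun p : G × N => p.1 • (p.2 : X) := contMDiff_fst.smul (hval.comp contMDiff_snd)
  exact ⟨fun p => (ContMDiffWithinAt.subtypeVal_comp_iff (⟨N, hN⟩ : TopologicalSpace.Opens X)
    (fun p : G × N => p.1 • p.2) Set.univ p).1 (hsmul p)⟩

end OpenInvariant

section TrivialIsotropy

variable {EG V : Type*} [NormedAddCommGroup EG] [NormedSpace ℝ EG] [FiniteDimensional ℝ EG]
  [NormedAddCommGroup V] [NormedSpace ℝ V] [FiniteDimensional ℝ V]
  {G : Type*} [TopologicalSpace G] [ChartedSpace EG G] [Group G] [LieGroup 𝓘(ℝ, EG) ∞ G]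
  [MulAction G V] [ContMDiffSMul 𝓘(ℝ, EG) 𝓘(ℝ, V) ∞ G V] {W : SubMulAction G V}

variable (EG) in
include EG in
theorem isOpen_trivialIsotropy (hW : IsOpen (W : Set V)) (hproper : IsProperAction G W) :
    IsOpen (W.trivialIsotropy : Set V) := by
  let : ChartedSpace V W := openChartedSpace hW
  have := isManifold_openChartedSpace (EX := V) hW
  have := contMDiffSMul_openChartedSpace (EG := EG) (EX := V) hW
  have himage : (W.trivialIsotropy : Set V) =
      Subtype.val '' {x : W | MulAction.stabilizer G x = ⊥} := by
    ext x
    refine ⟨fun hx => ⟨⟨x, hx.1⟩, (SubMulAction.stabilizer_of_subMul _).trans hx.2, rfl⟩, ?_⟩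
    rintro ⟨y, hy, rfl⟩
    exact ⟨y.2, (SubMulAction.stabilizer_of_subMul y).symm.trans hy⟩
  rw [himage]
  exact hW.isOpenMap_subtype_val _ (isOpen_setOf_stabilizer_eq_bot EG V hproper)

theorem hasPrincipalQuotient_trivialIsotropy (hW : IsOpen (W : Set V))
    (hproper : IsProperAction G W) :
    HasPrincipalQuotient EG W.trivialIsotropy (isOpen_trivialIsotropy EG hW hproper) := by
  have hN := isOpen_trivialIsotropy EG hW hproper
  let : ChartedSpace V W.trivialIsotropy := openChartedSpace hN
  have := isManifold_openChartedSpace (EX := V) hN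
  have := contMDiffSMul_openChartedSpace (EG := EG) (EX := V) hN
  have : ContinuousSMul G W.trivialIsotropy :=
    ContMDiffSMul.continuousSMul (I := 𝓘(ℝ, EG)) (I' := 𝓘(ℝ, V)) ∞
  have : ProperSpace V := FiniteDimensional.proper_real V
  have hproperN : IsProperAction G W.trivialIsotropy := hproper.mono fun _ hx => hx.1
  have hfree (x : W.trivialIsotropy) : MulAction.stabilizer G x = ⊥ :=
    (SubMulAction.stabilizer_of_subMul x).trans x.2.2
  exact ⟨hproperN.t2Space_quotient, ContinuousConstSMul.secondCountableTopology, _,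
    exists_chartedSpace_isSmoothPrincipalBundle (EN := V) hproperN hfree⟩

end TrivialIsotropy

/-! ### Smoothness of the action on Christoffel symbols -/

theorem contMDiffSMul_of_leftInverse {EG : Type*} [NormedAddCommGroup EG] [NormedSpace ℝ EG]
    {G : Type*} [TopologicalSpace G] [ChartedSpace EG G]
    {U V : Type*} [NormedAddCommGroup U] [NormedSpace ℝ U] [SMul G U]
    [NormedAddCommGroup V] [NormedSpace ℝ V] [SMul G V] [ContMDiffSMul 𝓘(ℝ, EG) 𝓘(ℝ, V) ∞ G V]
    {ι : U →L[ℝ] V} {L : V →L[ℝ] U} (hL : Function.LeftInverse L ι)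
    (hι : ∀ (g : G) (x : U), ι (g • x) = g • ι x) : ContMDiffSMul 𝓘(ℝ, EG) 𝓘(ℝ, U) ∞ G U := by
  have hsmul : ContMDiff (𝓘(ℝ, EG).prod 𝓘(ℝ, U)) 𝓘(ℝ, V) ∞ fun p : G × U => p.1 • ι p.2 :=
    contMDiff_fst.smul (ι.contMDiff.comp contMDiff_snd)
  refine ⟨(L.contMDiff.comp hsmul).congr fun p => ?_⟩
  rw [Function.comp_apply, ← hι, hL]

namespace Christoffel

variable {m : ℕ}

theorem contDiff_iff {n : ℕ∞ω} {E : Type*} [NormedAddCommGroup E] [NormedSpace ℝ E]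
    {f : E → Christoffel m} :
    ContDiff ℝ n f ↔ ∀ i j k, ContDiff ℝ n fun x => f x i j k := by
  refine contDiff_pi.trans (forall_congr' fun i => ?_)
  exact contDiff_pi.trans (forall_congr' fun j => contDiff_pi)

theorem contDiff_apply {n : ℕ∞ω} (i j k : Fin m) :
    ContDiff ℝ n fun Γ : Christoffel m => Γ i j k :=
  contDiff_iff.1 contDiff_id i j k

instance : ContMDiffSMul 𝓘(ℝ, Fin m → Fin m → ℝ) 𝓘(ℝ, Christoffel m) ∞
    GL(m, ℝ)⁺ (Christoffel m) where
  contMDiff_smul := by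
    let E := Fin m → Fin m → ℝ
    let P : E × E × Christoffel m → Christoffel m := fun x i j k =>
      ∑ a, ∑ b, ∑ c, x.1 a i * x.1 b j * x.2.1 k c * x.2.2 a b c
    have hP : ContDiff ℝ ∞ P := contDiff_iff.2 fun i j k =>
      ContDiff.sum fun a _ => ContDiff.sum fun b _ => ContDiff.sum fun c _ =>
        ContDiff.mul (by fun_prop) ((contDiff_apply a b c).comp (contDiff_snd.comp contDiff_snd))
    have hentries : ContMDiff (𝓘(ℝ, E).prod 𝓘(ℝ, Christoffel m)) 𝓘(ℝ, E) ∞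
        fun x : GL(m, ℝ)⁺ × Christoffel m => GLPos.entries x.1 :=
      GLPos.contMDiff_entries.comp contMDiff_fst
    have hentries_inv : ContMDiff (𝓘(ℝ, E).prod 𝓘(ℝ, Christoffel m)) 𝓘(ℝ, E) ∞
        fun x : GL(m, ℝ)⁺ × Christoffel m => GLPos.entries x.1⁻¹ :=
      GLPos.contMDiff_entries.comp ((contMDiff_inv 𝓘(ℝ, E) ∞).comp contMDiff_fst)
    refine (hP.contMDiff.comp
      (hentries_inv.prodMk_space (hentries.prodMk_space contMDiff_snd))).congr fun x => ?_
    change changeFrame (x.1 : GL (Fin m) ℝ)⁻¹ x.2 = _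
    funext i j k
    simp only [changeFrame, inv_inv]
    rfl

instance : ContMDiffSMul 𝓘(ℝ, Fin m → Fin m → ℝ) 𝓘(ℝ, symm m) ∞ GL(m, ℝ)⁺ (symm m) := by
  obtain ⟨L, hL⟩ := LinearMap.exists_leftInverse_of_injective (symm m).subtype
    (Submodule.ker_subtype _)
  exact contMDiffSMul_of_leftInverse (ι := (symm m).subtypeL)
    (L := LinearMap.toContinuousLinearMap L) (LinearMap.congr_fun hL) fun _ _ => rfl

end Christoffel

/-! ### Properness on definite Ricci tensors -/

section DefiniteForms

section LinearOrderedField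

variable {𝕜 M : Type*} [Field 𝕜] [LinearOrder 𝕜] [AddCommGroup M] [Module 𝕜 M]
  [FiniteDimensional 𝕜 M] {Q : QuadraticForm 𝕜 M}

theorem sigPos_eq_finrank_iff_posDef : sigPos Q = Module.finrank 𝕜 M ↔ Q.PosDef := by
  refine ⟨fun h x hx => ?_, fun h => (sigPos_le_finrank Q).antisymm ?_⟩
  · obtain ⟨V, hV, hpos⟩ := exists_finrank_eq_sigPos_and_posDef Q
    obtain rfl : V = ⊤ := Submodule.eq_top_of_finrank_eq (hV.trans h)
    exact hpos ⟨x, Submodule.mem_top⟩ fun h0 => hx (congrArg Subtype.val h0)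
  · have htop : (Q.restrict ⊤).PosDef := fun x hx => h x fun h0 => hx (Subtype.ext h0)
    simpa only [finrank_top] using le_sigPos_of_posDef Q htop

theorem signature_eq_zero_finrank_iff_posDef [IsStrictOrderedRing 𝕜] :
    sigNeg Q = 0 ∧ sigPos Q = Module.finrank 𝕜 M ↔ Q.PosDef := by
  rw [← sigPos_eq_finrank_iff_posDef, and_iff_right_iff_imp]
  have := QuadraticForm.sigPos_add_sigNeg_add_radical (Q := Q)
  lia

end LinearOrderedField

variable {ι : Type*} [Fintype ι]

/-- By compactness of the unit sphere, `x ⬝ᵥ B *ᵥ x` has a positive lower bound there, uniformly for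
`B` near `A`. -/
theorem exists_eventually_forall_mul_sq_le_dotProduct_mulVec {A : Matrix ι ι ℝ}
    (hA : ∀ x, x ≠ 0 → 0 < x ⬝ᵥ A *ᵥ x) :
    ∃ c > 0, ∀ᶠ B in 𝓝 A, ∀ x, c * ‖x‖ ^ 2 ≤ x ⬝ᵥ B *ᵥ x := by
  have hcont : Continuous fun p : Matrix ι ι ℝ × (ι → ℝ) => p.2 ⬝ᵥ p.1 *ᵥ p.2 :=
    continuous_snd.dotProduct (continuous_fst.matrix_mulVec continuous_snd)
  have hsphere : IsCompact (Metric.sphere (0 : ι → ℝ) 1) := isCompact_sphere _ _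
  obtain ⟨c, hc, hcA⟩ := hsphere.exists_forall_le' (f := fun x => x ⬝ᵥ A *ᵥ x)
    (hcont.comp (Continuous.prodMk_right A)).continuousOn (a := 0) fun x hx =>
      hA x (ne_zero_of_mem_unit_sphere ⟨x, hx⟩)
  have hnear : ∀ᶠ B in 𝓝 A, ∀ x ∈ Metric.sphere (0 : ι → ℝ) 1, c / 2 < x ⬝ᵥ B *ᵥ x :=
    hsphere.eventually_forall_of_forall_eventually fun x hx =>
      (hcont.tendsto (A, x)).eventually (lt_mem_nhds ((half_lt_self hc).trans_le (hcA x hx)))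
  refine ⟨c / 2, half_pos hc, hnear.mono fun B hB x => ?_⟩
  rcases eq_or_ne x 0 with rfl | hx
  · simp
  have hnorm : ‖x‖ ≠ 0 := norm_ne_zero_iff.2 hx
  have hunit := hB (‖x‖⁻¹ • x) (by simp [norm_smul, hnorm])
  calc c / 2 * ‖x‖ ^ 2
      ≤ (‖x‖⁻¹ • x) ⬝ᵥ B *ᵥ (‖x‖⁻¹ • x) * ‖x‖ ^ 2 := by gcongr
    _ = x ⬝ᵥ B *ᵥ x := by
      rw [Matrix.mulVec_smul, dotProduct_smul, smul_dotProduct, smul_eq_mul, smul_eq_mul]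
      field_simp

theorem mul_sq_entry_le_transpose_mul_mul {c : ℝ} (hc : 0 ≤ c) {B : Matrix ι ι ℝ}
    (hB : ∀ x, c * ‖x‖ ^ 2 ≤ x ⬝ᵥ B *ᵥ x) (S : Matrix ι ι ℝ) (i j : ι) :
    c * S i j ^ 2 ≤ (Sᵀ * B * S) j j := by
  classical
  have hentry : |S i j| ≤ ‖S.col j‖ := norm_le_pi_norm (S.col j) i
  calc c * S i j ^ 2 ≤ c * ‖S.col j‖ ^ 2 := by
        rw [← sq_abs]
        gcongr
    _ ≤ S.col j ⬝ᵥ B *ᵥ S.col j := hB _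
    _ = (Sᵀ * B * S) j j := by rw [Matrix.mul_assoc, Matrix.mul_apply_eq_vecMul]; rfl

end DefiniteForms

namespace GLPos

theorem exists_subseq_tendsto {m : ℕ} {T : ℕ → GL(m, ℝ)⁺}
    (hT : (fun n => entries (T n)) =O[atTop] fun _ => (1 : ℝ))
    (hT_inv : (fun n => entries (T n)⁻¹) =O[atTop] fun _ => (1 : ℝ)) :
    ∃ (φ : ℕ → ℕ) (S : GL(m, ℝ)⁺), StrictMono φ ∧ Tendsto (fun n => T (φ n)) atTop (𝓝 S) := by
  obtain ⟨C, hC⟩ := (hT.prod_left hT_inv).bound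
  have hbound : ∀ᶠ n in atTop, (entries (T n), entries (T n)⁻¹) ∈ Metric.closedBall 0 C :=
    hC.mono fun n hn => by simpa only [mem_closedBall_zero_iff, norm_one, mul_one] using hn
  obtain ⟨⟨A, B⟩, -, φ, hφ, hlim⟩ := tendsto_subseq_of_frequently_bounded
    Metric.isBounded_closedBall hbound.frequently
  have hA : Tendsto (fun n => entries (T (φ n))) atTop (𝓝 A) :=
    (continuous_fst.tendsto (A, B)).comp hlim
  have hmul : Matrix.of A * Matrix.of B = 1 := by
    have hcont : Continuous fun x : (Fin m → Fin m → ℝ) × (Fin m → Fin m → ℝ) =>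
        (Matrix.of x.1 * Matrix.of x.2 : Matrix (Fin m) (Fin m) ℝ) :=
      Continuous.matrix_mul continuous_fst continuous_snd
    refine tendsto_nhds_unique ((hcont.tendsto (A, B)).comp hlim) ?_
    exact tendsto_const_nhds.congr fun n => ((T (φ n) : GL (Fin m) ℝ).mul_inv).symm
  have hdet : 0 < (Matrix.of A).det := by
    have hnonneg : 0 ≤ (Matrix.of A).det :=
      ge_of_tendsto' ((contDiff_det.continuous.tendsto A).comp hA) fun n => (T (φ n)).2.le
    have hunit : IsUnit (Matrix.of A).det :=
      (Matrix.isUnit_iff_isUnit_det _).1 (IsUnit.of_mul_eq_one _ hmul)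
    exact hnonneg.lt_of_ne hunit.ne_zero.symm
  let S : GL(m, ℝ)⁺ := ⟨⟨Matrix.of A, Matrix.of B, hmul, mul_eq_one_comm.1 hmul⟩, hdet⟩
  exact ⟨φ, S, hφ, isOpenEmbedding_entries.tendsto_nhds_iff.2 hA⟩

end GLPos

namespace Christoffel

variable {m : ℕ}

theorem toQuadraticForm'_symRicci_apply (Γ : Christoffel m) (x : Fin m → ℝ) :
    Γ.symRicci.toQuadraticForm' x = x ⬝ᵥ Γ.symRicci *ᵥ x :=
  Matrix.toLinearMap₂'_apply' Γ.symRicci x x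

theorem continuous_symRicci : Continuous (symRicci (m := m)) := by
  have hricci : Continuous (ricci (m := m)) := by
    have happly (i j k : Fin m) : Continuous fun Γ : Christoffel m => Γ i j k :=
      (contDiff_apply (n := 0) i j k).continuous
    refine continuous_matrix fun j k => ?_
    simp only [ricci, Matrix.of_apply]
    exact continuous_finsetSum _ fun i _ => continuous_finsetSum _ fun n _ =>
      ((happly i n i).mul (happly j k n)).sub ((happly j n i).mul (happly i k n))
  exact (hricci.add hricci.matrix_transpose).const_smul (1 / 2 : ℝ)

variable {p q : ℕ}

theorem exists_hasSignature_iff (hpq : (p, q) = (m, 0) ∨ (p, q) = (0, m)) :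
    ∃ c : ℝ, ∀ Γ : Christoffel m, Γ.HasSignature p q ↔
      ∀ x, x ≠ 0 → 0 < x ⬝ᵥ (c • Γ.symRicci) *ᵥ x := by
  have hposDef (Q : QuadraticForm ℝ (Fin m → ℝ)) : sigNeg Q = 0 ∧ sigPos Q = m ↔ Q.PosDef := by
    rw [← signature_eq_zero_finrank_iff_posDef, Module.finrank_fin_fun]
  rcases hpq with h | h <;> obtain ⟨rfl, rfl⟩ := Prod.mk.inj h
  · refine ⟨-1, fun Γ => ?_⟩
    have hneg := hposDef (-Γ.symRicci.toQuadraticForm')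
    rw [sigNeg_neg, sigPos_neg] at hneg
    rw [HasSignature, and_comm, hneg]
    refine forall₂_congr fun x _ => ?_
    rw [neg_apply, toQuadraticForm'_symRicci_apply, Matrix.smul_mulVec, dotProduct_smul,
      neg_one_smul]
  · refine ⟨1, fun Γ => ?_⟩
    rw [HasSignature, hposDef]
    refine forall₂_congr fun x _ => ?_
    rw [toQuadraticForm'_symRicci_apply, one_smul]

theorem det_symRicci_ne_zero (hpq : (p, q) = (m, 0) ∨ (p, q) = (0, m)) {Γ : Christoffel m}
    (hΓ : Γ.HasSignature p q) : Γ.symRicci.det ≠ 0 := by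
  obtain ⟨c, hc⟩ := exists_hasSignature_iff hpq
  intro hdet
  obtain ⟨x, hx, hx0⟩ := Matrix.exists_mulVec_eq_zero_iff.2 hdet
  have hpos := (hc Γ).1 hΓ x hx
  rw [Matrix.smul_mulVec, hx0, smul_zero, dotProduct_zero] at hpos
  exact hpos.false

theorem isOpen_W (hpq : (p, q) = (m, 0) ∨ (p, q) = (0, m)) :
    IsOpen (W m p q : Set (Christoffel m)) := by
  obtain ⟨c, hc⟩ := exists_hasSignature_iff hpq
  refine isOpen_iff_mem_nhds.2 fun Γ hΓ => ?_
  obtain ⟨d, hd, hnear⟩ := exists_eventually_forall_mul_sq_le_dotProduct_mulVec ((hc Γ).1 hΓ)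
  filter_upwards [(continuous_symRicci.const_smul c).continuousAt.eventually hnear] with Δ hΔ
  refine (hc Δ).2 fun x hx => lt_of_lt_of_le ?_ (hΔ x)
  have := norm_pos_iff.2 hx
  positivity

theorem isOpen_Z (hpq : (p, q) = (m, 0) ∨ (p, q) = (0, m)) :
    IsOpen (Z m p q : Set (symm m)) :=
  (isOpen_W hpq).preimage continuous_subtype_val

theorem isBigO_entries_inv (hpq : (p, q) = (m, 0) ∨ (p, q) = (0, m))
    {Γ : ℕ → Christoffel m} {T : ℕ → GL(m, ℝ)⁺} {a b : Christoffel m} (ha : a ∈ W m p q)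
    (hΓ : Tendsto Γ atTop (𝓝 a)) (hT : Tendsto (fun n => T n • Γ n) atTop (𝓝 b)) :
    (fun n => GLPos.entries (T n)⁻¹) =O[atTop] fun _ => (1 : ℝ) := by
  obtain ⟨c, hc⟩ := exists_hasSignature_iff hpq
  obtain ⟨d, hd, hnear⟩ := exists_eventually_forall_mul_sq_le_dotProduct_mulVec ((hc a).1 ha)
  have hcont : Continuous fun Δ : Christoffel m => c • Δ.symRicci :=
    continuous_symRicci.const_smul c
  refine Asymptotics.isBigO_pi.2 fun i => Asymptotics.isBigO_pi.2 fun j => ?_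
  have hdiag : (fun n => (c • (T n • Γ n).symRicci) j j) =O[atTop] fun _ => (1 : ℝ) :=
    (((hcont.matrix_elem j j).tendsto b).comp hT).isBigO_one ℝ
  have hsq : (fun n => d * GLPos.entries (T n)⁻¹ i j ^ 2) =O[atTop]
      fun n => (c • (T n • Γ n).symRicci) j j := by
    refine Asymptotics.IsBigO.of_norm_eventuallyLE ?_
    filter_upwards [(hcont.tendsto a).comp hΓ |>.eventually hnear] with n hn
    rw [Real.norm_of_nonneg (by positivity)]
    have hsmul : c • (T n • Γ n).symRicci =
        (T n : GL (Fin m) ℝ)⁻¹.1ᵀ * (c • (Γ n).symRicci) * (T n : GL (Fin m) ℝ)⁻¹.1 := by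
      rw [Matrix.mul_smul, Matrix.smul_mul, ← symRicci_changeFrame]
      rfl
    rw [hsmul]
    exact mul_sq_entry_le_transpose_mul_mul hd.le hn _ i j
  refine Asymptotics.IsBigO.of_pow (n := 2) two_ne_zero ?_
  simpa only [Pi.pow_def, one_pow] using
    (Asymptotics.isBigO_const_mul_left_iff hd.ne').1 (hsq.trans hdiag)

/-- Boundedness of `T n` follows from that of the inverses applied to the inverse sequence, which
carries `T n • Γ n` back to `Γ n`. -/
theorem exists_subseq_tendsto (hpq : (p, q) = (m, 0) ∨ (p, q) = (0, m))
    {Γ : ℕ → Christoffel m} {T : ℕ → GL(m, ℝ)⁺} {a b : Christoffel m} (ha : a ∈ W m p q)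
    (hb : b ∈ W m p q) (hΓ : Tendsto Γ atTop (𝓝 a))
    (hT : Tendsto (fun n => T n • Γ n) atTop (𝓝 b)) :
    ∃ (φ : ℕ → ℕ) (S : GL(m, ℝ)⁺), StrictMono φ ∧ Tendsto (fun n => T (φ n)) atTop (𝓝 S) := by
  refine GLPos.exists_subseq_tendsto ?_ (isBigO_entries_inv hpq ha hΓ hT)
  simpa only [inv_inv] using isBigO_entries_inv (T := fun n => (T n)⁻¹) hpq hb hT
    (by simpa only [inv_smul_smul] using hΓ)

theorem isProperAction_W (hpq : (p, q) = (m, 0) ∨ (p, q) = (0, m)) :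
    IsProperAction GL(m, ℝ)⁺ (W m p q) := fun _ _ a b hx hg =>
  exists_subseq_tendsto hpq a.2 b.2 ((continuous_subtype_val.tendsto a).comp hx)
    ((continuous_subtype_val.tendsto b).comp hg)

theorem isProperAction_Z (hpq : (p, q) = (m, 0) ∨ (p, q) = (0, m)) :
    IsProperAction GL(m, ℝ)⁺ (Z m p q) := fun _ _ a b hx hg =>
  have hval : Continuous fun x : Z m p q => ((x : symm m) : Christoffel m) :=
    continuous_subtype_val.comp continuous_subtype_val
  exists_subseq_tendsto hpq a.2 b.2 ((hval.tendsto a).comp hx) ((hval.tendsto b).comp hg)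

end Christoffel

/-! ### Genericity of trivial isotropy -/

section Analytic

variable {𝕜 ι : Type*} [NontriviallyNormedField 𝕜] [Fintype ι] [DecidableEq ι] {n : ℕ∞ω}
  {E : Type*} [NormedAddCommGroup E] [NormedSpace 𝕜 E] {A : E → Matrix ι ι 𝕜}

theorem contDiff_matrix_det (hA : ∀ i j, ContDiff 𝕜 n fun x => A x i j) :
    ContDiff 𝕜 n fun x => (A x).det := by
  simp only [Matrix.det_apply]
  exact ContDiff.sum fun σ _ => ContDiff.const_smul _ (contDiff_prod fun i _ => hA (σ i) i)

theorem contDiff_matrix_adjugate (hA : ∀ i j, ContDiff 𝕜 n fun x => A x i j) (i j : ι) :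
    ContDiff 𝕜 n fun x => (A x).adjugate i j := by
  simp only [Matrix.adjugate_apply]
  refine contDiff_matrix_det fun k l => ?_
  simp only [Matrix.updateRow_apply]
  split_ifs
  exacts [contDiff_const, hA k l]

theorem dense_setOf_ne_zero_of_contDiff_omega {V : Type*} [NormedAddCommGroup V] [NormedSpace ℝ V]
    {f : V → ℝ} (hf : ContDiff ℝ ω f) {x₀ : V} (hx₀ : f x₀ ≠ 0) : Dense {x | f x ≠ 0} := by
  intro x
  rw [mem_closure_iff_frequently]
  intro hzero
  have hzero' : ∀ᶠ y in 𝓝 x, f y = 0 := hzero.mono fun y hy => not_not.1 hy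
  have hf0 : f = fun _ => 0 :=
    (contDiff_omega_iff_analyticOnNhd.1 hf).eq_of_eventuallyEq analyticOnNhd_const hzero'
  exact hx₀ (congrFun hf0 x₀)

end Analytic

namespace Christoffel

variable {m : ℕ}

/-- The matrix of `y ↦ Γ(x, y)`. -/
def leftMul (Γ : Christoffel m) (x : Fin m → ℝ) : Matrix (Fin m) (Fin m) ℝ :=
  ∑ i, x i • (Matrix.of (Γ i))ᵀ

/-- The covector `x ↦ tr Γ(x, ·)`. -/
def traceCovector (Γ : Christoffel m) : Fin m → ℝ := fun i => ∑ j, Γ i j j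

/-- The bilinear form `(x, y) ↦ tr Γ(Γ(x, y), ·)`. -/
def traceForm (Γ : Christoffel m) : Matrix (Fin m) (Fin m) ℝ :=
  Matrix.of fun i j => ∑ k, Γ.traceCovector k * Γ i j k

/-- Vectors attached to `Γ` equivariantly under the changes of frame of determinant `± 1`: the first
one is obtained from `traceCovector` by raising its index with `traceForm` (with the adjugate in
place of the inverse, to keep the components polynomial in `Γ`), and each of the others from its
predecessor by `v ↦ Γ(v, v)`. -/
def invariantVector (Γ : Christoffel m) : ℕ → Fin m → ℝ
  | 0 => Γ.traceForm.adjugate *ᵥ Γ.traceCovector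
  | k + 1 => Γ.leftMul (Γ.invariantVector k) *ᵥ Γ.invariantVector k

/-- The matrix whose columns are the first `m` invariant vectors of `Γ`. -/
def invariantFrame (Γ : Christoffel m) : Matrix (Fin m) (Fin m) ℝ :=
  Matrix.of fun i k => Γ.invariantVector k i

theorem leftMul_mulVec_apply (Γ : Christoffel m) (x y : Fin m → ℝ) (k : Fin m) :
    (Γ.leftMul x *ᵥ y) k = ∑ i, ∑ j, x i * y j * Γ i j k := by
  simp only [leftMul, Matrix.sum_mulVec, Finset.sum_apply, Matrix.smul_mulVec, Pi.smul_apply,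
    smul_eq_mul]
  simp only [Matrix.mulVec, dotProduct, Matrix.transpose_apply, Matrix.of_apply, Finset.mul_sum,
    mul_left_comm, mul_comm]

theorem traceCovector_dotProduct (Γ : Christoffel m) (x : Fin m → ℝ) :
    Γ.traceCovector ⬝ᵥ x = (Γ.leftMul x).trace := by
  simp only [leftMul, Matrix.trace_sum, Matrix.trace_smul, Matrix.trace_transpose, smul_eq_mul,
    dotProduct, mul_comm]
  rfl

theorem vecMul_traceForm (Γ : Christoffel m) (x : Fin m → ℝ) :
    x ᵥ* Γ.traceForm = Γ.traceCovector ᵥ* Γ.leftMul x := by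
  funext j
  simp only [leftMul, traceForm, Matrix.vecMul, dotProduct, Matrix.sum_apply, Matrix.smul_apply,
    Matrix.transpose_apply, Matrix.of_apply, smul_eq_mul, Finset.mul_sum]
  rw [Finset.sum_comm]
  simp only [mul_left_comm]

section ChangeFrame

variable (S : GL (Fin m) ℝ) (Γ : Christoffel m)

theorem leftMul_changeFrame (x : Fin m → ℝ) :
    (changeFrame S Γ).leftMul x = S⁻¹.1 * Γ.leftMul (S.1 *ᵥ x) * S.1 := by
  simp only [leftMul, changeFrame_eq, Matrix.transpose_mul, Matrix.transpose_transpose,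
    Matrix.transpose_sum, Matrix.transpose_smul, Matrix.mulVec, dotProduct, Finset.sum_smul,
    Matrix.mul_sum, Matrix.sum_mul, Finset.smul_sum, Matrix.mul_smul, Matrix.smul_mul, smul_smul,
    Matrix.mul_assoc]
  rw [Finset.sum_comm]
  simp only [mul_comm]

theorem traceCovector_changeFrame :
    (changeFrame S Γ).traceCovector = Γ.traceCovector ᵥ* S.1 := by
  refine dotProduct_eq _ _ fun x => ?_
  rw [traceCovector_dotProduct, leftMul_changeFrame, Matrix.trace_mul_comm, ← Matrix.mul_assoc,
    S.mul_inv, Matrix.one_mul, ← traceCovector_dotProduct, Matrix.dotProduct_mulVec]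

theorem traceForm_changeFrame : (changeFrame S Γ).traceForm = S.1ᵀ * Γ.traceForm * S.1 := by
  refine Matrix.ext_of_single_vecMul fun i => ?_
  rw [vecMul_traceForm, leftMul_changeFrame, traceCovector_changeFrame, Matrix.vecMul_vecMul,
    ← Matrix.mul_assoc, ← Matrix.mul_assoc, S.mul_inv, Matrix.one_mul, ← Matrix.vecMul_vecMul,
    ← vecMul_traceForm, ← Matrix.vecMul_vecMul, ← Matrix.vecMul_vecMul, Matrix.vecMul_transpose]

theorem mulVec_invariantVector_changeFrame (hS : S.1.det ^ 2 = 1) (k : ℕ) :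
    S.1 *ᵥ (changeFrame S Γ).invariantVector k = Γ.invariantVector k := by
  induction k with
  | zero =>
    have hadjugate : S.1 * (changeFrame S Γ).traceForm.adjugate * S.1ᵀ = Γ.traceForm.adjugate :=
      calc S.1 * (changeFrame S Γ).traceForm.adjugate * S.1ᵀ
          = (S.1 * S.1.adjugate) * Γ.traceForm.adjugate * (S.1ᵀ.adjugate * S.1ᵀ) := by
            simp only [traceForm_changeFrame, Matrix.adjugate_mul_distrib, Matrix.mul_assoc]
        _ = S.1.det ^ 2 • Γ.traceForm.adjugate := by
            simp only [Matrix.mul_adjugate, Matrix.adjugate_mul, Matrix.det_transpose,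
              Matrix.smul_mul, Matrix.mul_smul, Matrix.one_mul, Matrix.mul_one, smul_smul, sq]
        _ = Γ.traceForm.adjugate := by rw [hS, one_smul]
    simp only [invariantVector]
    rw [traceCovector_changeFrame, ← Matrix.mulVec_transpose, Matrix.mulVec_mulVec,
      Matrix.mulVec_mulVec, hadjugate]
  | succ k ih =>
    simp only [invariantVector]
    rw [leftMul_changeFrame, ih, Matrix.mulVec_mulVec, ← Matrix.mul_assoc, ← Matrix.mul_assoc,
      S.mul_inv, Matrix.one_mul, ← Matrix.mulVec_mulVec, ih]

end ChangeFrame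

theorem eq_one_of_changeFrame_eq {S : GL (Fin m) ℝ} {Γ : Christoffel m}
    (hS : changeFrame S Γ = Γ) (hricci : Γ.symRicci.det ≠ 0) (hframe : Γ.invariantFrame.det ≠ 0) :
    S = 1 := by
  have hdet : S.1.det ^ 2 = 1 := by
    have h := congrArg Matrix.det (symRicci_changeFrame S Γ)
    rw [hS, Matrix.det_mul, Matrix.det_mul, Matrix.det_transpose] at h
    exact mul_right_cancel₀ hricci (by linear_combination -h)
  have hfix (k : ℕ) : S.1 *ᵥ Γ.invariantVector k = Γ.invariantVector k := by
    simpa only [hS] using mulVec_invariantVector_changeFrame S Γ hdet k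
  have hmul : S.1 * Γ.invariantFrame = 1 * Γ.invariantFrame := by
    rw [Matrix.one_mul]
    ext i k
    exact congrFun (hfix k) i
  exact Units.ext (((Matrix.isUnit_iff_isUnit_det _).2 hframe.isUnit).mul_right_cancel hmul)

theorem contDiff_traceCovector (i : Fin m) :
    ContDiff ℝ ω fun Γ : Christoffel m => Γ.traceCovector i :=
  ContDiff.sum fun j _ => contDiff_apply i j j

theorem contDiff_traceForm (i j : Fin m) :
    ContDiff ℝ ω fun Γ : Christoffel m => Γ.traceForm i j := by
  simp only [traceForm, Matrix.of_apply]
  exact ContDiff.sum fun k _ => (contDiff_traceCovector k).mul (contDiff_apply i j k)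

theorem contDiff_invariantVector (k : ℕ) (i : Fin m) :
    ContDiff ℝ ω fun Γ : Christoffel m => Γ.invariantVector k i := by
  induction k generalizing i with
  | zero =>
    simp only [invariantVector, Matrix.mulVec, dotProduct]
    exact ContDiff.sum fun j _ =>
      (contDiff_matrix_adjugate contDiff_traceForm i j).mul (contDiff_traceCovector j)
  | succ k ih =>
    simp only [invariantVector, leftMul_mulVec_apply]
    exact ContDiff.sum fun a _ => ContDiff.sum fun b _ =>
      ((ih a).mul (ih b)).mul (contDiff_apply a b i)

theorem contDiff_det_invariantFrame :
    ContDiff ℝ ω fun Γ : Christoffel m => Γ.invariantFrame.det :=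
  contDiff_matrix_det fun i k => contDiff_invariantVector k i

/-- The Christoffel symbols with `Γ(e_i, e_i) = e_0 + e_{i+1}` for `i < m - 1`,
`Γ(e_{m-1}, e_{m-1}) = e_0` and all other components zero: an example whose invariant frame is
triangular. -/
def chain (m : ℕ) : Christoffel m := fun i j k =>
  if i = j then (if k.val = 0 then 1 else 0) + (if k.val = i.val + 1 then 1 else 0) else 0

theorem chain_mem_symm : chain m ∈ symm m := by
  intro i j k
  by_cases h : i = j
  · rw [h]
  · simp only [chain, if_neg h, if_neg (Ne.symm h)]

theorem traceCovector_chain (i : Fin m) :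
    (chain m).traceCovector i = if i.val = 0 then 1 else 0 := by
  simp [traceCovector, chain, Finset.sum_ite_eq]

theorem traceForm_chain : (chain m).traceForm = 1 := by
  ext i j
  have hm : 0 < m := i.pos
  simp only [traceForm, Matrix.of_apply, traceCovector_chain]
  rw [Finset.sum_eq_single (⟨0, hm⟩ : Fin m)]
  · simp [chain, Matrix.one_apply]
  · intro n _ hn
    simp [Fin.val_ne_of_ne hn]
  · simp

theorem invariantVector_chain_succ_apply (k : ℕ) {i j : Fin m} (hij : i.val = j.val + 1) :
    (chain m).invariantVector (k + 1) i = (chain m).invariantVector k j ^ 2 := by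
  have hval (a : Fin m) : j.val = a.val ↔ j = a := Fin.ext_iff.symm
  simp [invariantVector, leftMul_mulVec_apply, chain, hij, hval, sq]

theorem invariantVector_chain_apply_of_lt {k : ℕ} {i : Fin m} (hki : k < i.val) :
    (chain m).invariantVector k i = 0 := by
  induction k generalizing i with
  | zero =>
    simp only [invariantVector, traceForm_chain, Matrix.adjugate_one, Matrix.one_mulVec,
      traceCovector_chain, if_neg hki.ne']
  | succ k ih =>
    let j : Fin m := ⟨i.val - 1, by lia⟩
    rw [invariantVector_chain_succ_apply k (j := j) (by grind), ih (by grind), zero_pow two_ne_zero]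

theorem invariantVector_chain_apply_self (i : Fin m) : (chain m).invariantVector i i = 1 := by
  obtain ⟨k, hk⟩ := i
  induction k with
  | zero =>
    simp only [invariantVector, traceForm_chain, Matrix.adjugate_one, Matrix.one_mulVec,
      traceCovector_chain, if_true]
  | succ k ih =>
    rw [invariantVector_chain_succ_apply k (j := ⟨k, by lia⟩) rfl, ih, one_pow]

theorem det_invariantFrame_chain : (chain m).invariantFrame.det = 1 := by
  have htriangular : (chain m).invariantFrame.IsUpperTriangular := fun _ _ hij =>
    invariantVector_chain_apply_of_lt hij
  rw [Matrix.det_of_isUpperTriangular htriangular]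
  exact Finset.prod_eq_one fun i _ => invariantVector_chain_apply_self i

variable {p q : ℕ}

theorem stabilizer_eq_bot (hpq : (p, q) = (m, 0) ∨ (p, q) = (0, m)) {Γ : Christoffel m}
    (hΓ : Γ.HasSignature p q) (hframe : Γ.invariantFrame.det ≠ 0) :
    MulAction.stabilizer GL(m, ℝ)⁺ Γ = ⊥ :=
  (Subgroup.eq_bot_iff_forall _).2 fun _ hT =>
    Subtype.ext (inv_eq_one.1 (eq_one_of_changeFrame_eq hT (det_symRicci_ne_zero hpq hΓ) hframe))

theorem dense_WTilde (hpq : (p, q) = (m, 0) ∨ (p, q) = (0, m)) :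
    Dense {Γ : W m p q | Γ.1 ∈ WTilde m p q} := by
  have hdense := dense_setOf_ne_zero_of_contDiff_omega contDiff_det_invariantFrame
    (det_invariantFrame_chain.trans_ne (one_ne_zero (α := ℝ)) : (chain m).invariantFrame.det ≠ 0)
  refine (hdense.preimage (isOpen_W hpq).isOpenMap_subtype_val).mono fun Γ hΓ => ?_
  exact ⟨Γ.2, stabilizer_eq_bot hpq Γ.2 hΓ⟩

theorem dense_ZTilde (hpq : (p, q) = (m, 0) ∨ (p, q) = (0, m)) :
    Dense {Γ : Z m p q | Γ.1 ∈ ZTilde m p q} := by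
  have hdense := dense_setOf_ne_zero_of_contDiff_omega
    (contDiff_det_invariantFrame.comp (symm m).subtypeL.contDiff) (x₀ := ⟨chain m, chain_mem_symm⟩)
    (det_invariantFrame_chain.trans_ne one_ne_zero)
  refine (hdense.preimage (isOpen_Z hpq).isOpenMap_subtype_val).mono fun Γ hΓ => ⟨Γ.2, ?_⟩
  rw [eq_bot_iff, ← stabilizer_eq_bot hpq Γ.2 hΓ]
  exact fun T hT => congrArg Subtype.val hT

end Christoffel

theorem theorem1p8_general (m p q : ℕ)
    (hpq : (p, q) = (m, 0) ∨ (p, q) = (0, m)) :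
    (IsProperAction GL(m, ℝ)⁺ (Christoffel.W m p q) ∧
      IsProperAction GL(m, ℝ)⁺ (Christoffel.Z m p q)) ∧
    ((IsOpen {Γ : Christoffel.W m p q | Γ.1 ∈ Christoffel.WTilde m p q} ∧
        Dense {Γ : Christoffel.W m p q | Γ.1 ∈ Christoffel.WTilde m p q}) ∧
      (IsOpen {Γ : Christoffel.Z m p q | Γ.1 ∈ Christoffel.ZTilde m p q} ∧
        Dense {Γ : Christoffel.Z m p q | Γ.1 ∈ Christoffel.ZTilde m p q})) ∧
    ((∃ hW : IsOpen (Christoffel.WTilde m p q : Set (Christoffel m)),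
        HasPrincipalQuotient (Fin m → Fin m → ℝ) (Christoffel.WTilde m p q) hW) ∧
      (∃ hZ : IsOpen (Christoffel.ZTilde m p q : Set (Christoffel.symm m)),
        HasPrincipalQuotient (Fin m → Fin m → ℝ) (Christoffel.ZTilde m p q) hZ)) := by
  have hpW := Christoffel.isProperAction_W hpq
  have hpZ := Christoffel.isProperAction_Z hpq
  have hW := isOpen_trivialIsotropy (Fin m → Fin m → ℝ) (Christoffel.isOpen_W hpq) hpW
  have hZ := isOpen_trivialIsotropy (Fin m → Fin m → ℝ) (Christoffel.isOpen_Z hpq) hpZ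
  exact ⟨⟨hpW, hpZ⟩,
    ⟨⟨hW.preimage continuous_subtype_val, Christoffel.dense_WTilde hpq⟩,
      ⟨hZ.preimage continuous_subtype_val, Christoffel.dense_ZTilde hpq⟩⟩,
    ⟨hW, hasPrincipalQuotient_trivialIsotropy (Christoffel.isOpen_W hpq) hpW⟩,
    ⟨hZ, hasPrincipalQuotient_trivialIsotropy (Christoffel.isOpen_Z hpq) hpZ⟩⟩

theorem theorem1p8 (m : ℕ) (hm : 3 ≤ m) (p q : ℕ)
    (hpq : (p, q) = (m, 0) ∨ (p, q) = (0, m)) :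
    (IsProperAction GL(m, ℝ)⁺ (Christoffel.W m p q) ∧
      IsProperAction GL(m, ℝ)⁺ (Christoffel.Z m p q)) ∧
    ((IsOpen {Γ : Christoffel.W m p q | Γ.1 ∈ Christoffel.WTilde m p q} ∧
        Dense {Γ : Christoffel.W m p q | Γ.1 ∈ Christoffel.WTilde m p q}) ∧
      (IsOpen {Γ : Christoffel.Z m p q | Γ.1 ∈ Christoffel.ZTilde m p q} ∧
        Dense {Γ : Christoffel.Z m p q | Γ.1 ∈ Christoffel.ZTilde m p q})) ∧
    ((∃ hW : IsOpen (Christoffel.WTilde m p q : Set (Christoffel m)),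
        HasPrincipalQuotient (Fin m → Fin m → ℝ) (Christoffel.WTilde m p q) hW) ∧
      (∃ hZ : IsOpen (Christoffel.ZTilde m p q : Set (Christoffel.symm m)),
        HasPrincipalQuotient (Fin m → Fin m → ℝ) (Christoffel.ZTilde m p q) hZ)) :=
  theorem1p8_general m p q hpq
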